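/- Let $k$ be a field of prime characteristic $p$, let $d\ge 0$ be an integer with $p\ge 2d$, and let $H_1$ be the Heisenberg group scheme over $k$, i.e. the affine group scheme of the matrices $\begin{pmatrix}1&x&z\\0&1&y\\0&0&1\end{pmatrix}$. It is represented by the Hopf algebra $A=k[x,y,z]$ with $\Delta(x)=1\otimes x+x\otimes 1$, $\Delta(y)=1\otimes y+y\otimes 1$, $\Delta(z)=1\otimes z+x\otimes y+z\otimes 1$ and counit $\varepsilon(x)=\varepsilon(y)=\varepsilon(z)=0$. A $d$-dimensional representation of $H_1$ is a right $A$-comodule $\rho:V\to V\otimes_k A$ on a $d$-dimensional vector space $V$; its matrix formula in a basis $e_1,\dots,e_d$ of $V$ is the matrix $(a_{ij})$ over $A$ with $\rho(e_j)=\sum_i e_i\otimes a_{ij}$. Consider finite families $X_0,Y_0,Z_0,\dots,X_m,Y_m,Z_m$ ($m\ge 0$) of nilpotent $d\times d$ matrices over $k$ such that (1) $[X_i,Y_i]=Z_i$ and $[Z_i,X_i]=[Z_i,Y_i]=0$ for every $i$; (2) whenever $i\ne j$, each of $X_i,Y_i,Z_i$ commutes with each of $X_j,Y_j,Z_j$.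 Then for every $d$-dimensional vector space $V$ over $k$ and every basis of $V$: (a) For every representation of $H_1$ on $V$ there is such a family for which the matrix formula of the representation in the given basis is the ordered product $$e^{xX_0+yY_0+(z-xy/2)Z_0}\,e^{x^pX_1+y^pY_1+(z^p-x^py^p/2)Z_1}\cdots e^{x^{p^m}X_m+y^{p^m}Y_m+(z^{p^m}-x^{p^m}y^{p^m}/2)Z_m}.$$ (b) Conversely, for every such family the exponents in this product are nilpotent, and the product is the matrix formula, in the given basis, of a representation of $H_1$ on $V$. Here $e^M=\sum_n M^n/n!$ for a nilpotent $d\times d$ matrix $M$ over $A$, the sum running over the $n$ with $M^n\ne 0$; these $n$ satisfy $n<d\le p$, so that $n!$ is invertible in $k$. (If $p=2$, then $d\le 1$, all the matrices $X_i,Y_i,Z_i$ vanish, and the terms with $1/2$ are read as $0$.) -/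

import Mathlib

open scoped TensorProduct

/-- The coordinate algebra `k[x, y, z]` of the Heisenberg group `H₁` of matrices
`!![1, x, z; 0, 1, y; 0, 0, 1]`; the variables `0, 1, 2` are `x, y, z`. It is a type of its own,
because Mathlib equips `MvPolynomial` with the coalgebra structure of a monoid algebra (in which
the monomials are group-like), which is not the one that is meant here. -/
def HeisenbergAlgebra (k : Type*) [CommRing k] : Type _ := MvPolynomial (Fin 3) k

namespace HeisenbergAlgebra

variable (k : Type*) [CommRing k]

noncomputable instance instCommRing : CommRing (HeisenbergAlgebra k) :=
  inferInstanceAs (CommRing (MvPolynomial (Fin 3) k))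

noncomputable instance instAlgebra : Algebra k (HeisenbergAlgebra k) :=
  inferInstanceAs (Algebra k (MvPolynomial (Fin 3) k))

/-- The identification with the polynomial ring. -/
noncomputable def toPoly : HeisenbergAlgebra k ≃ₐ[k] MvPolynomial (Fin 3) k :=
  AlgEquiv.refl (R := k) (A₁ := MvPolynomial (Fin 3) k)

/-- The coordinate function `x`. -/
noncomputable def x : HeisenbergAlgebra k := (toPoly k).symm (MvPolynomial.X 0)

/-- The coordinate function `y`. -/
noncomputable def y : HeisenbergAlgebra k := (toPoly k).symm (MvPolynomial.X 1)

/-- The coordinate function `z`. -/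
noncomputable def z : HeisenbergAlgebra k := (toPoly k).symm (MvPolynomial.X 2)

/-- The algebra homomorphism out of `k[x, y, z]` with prescribed values at `x`, `y` and `z`. -/
noncomputable def lift {B : Type*} [CommRing B] [Algebra k B] (u v w : B) :
    HeisenbergAlgebra k →ₐ[k] B :=
  (MvPolynomial.aeval ![u, v, w]).comp (toPoly k).toAlgHom

section lift

variable {B : Type*} [CommRing B] [Algebra k B] (u v w : B)

@[simp] theorem lift_x : lift k u v w (x k) = u := by simp [lift, x]

@[simp] theorem lift_y : lift k u v w (y k) = v := by simp [lift, y]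

@[simp] theorem lift_z : lift k u v w (z k) = w := by simp [lift, z]

end lift

theorem hom_ext {B : Type*} [Semiring B] [Algebra k B] {f g : HeisenbergAlgebra k →ₐ[k] B}
    (hx : f (x k) = g (x k)) (hy : f (y k) = g (y k)) (hz : f (z k) = g (z k)) : f = g := by
  have h : f.comp (toPoly k).symm.toAlgHom = g.comp (toPoly k).symm.toAlgHom := by
    apply MvPolynomial.algHom_ext
    intro i
    fin_cases i
    exacts [hx, hy, hz]
  ext a
  simpa using DFunLike.congr_fun h (toPoly k a)

/-- The comultiplication: `x ↦ 1 ⊗ x + x ⊗ 1`, `y ↦ 1 ⊗ y + y ⊗ 1`,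
`z ↦ 1 ⊗ z + x ⊗ y + z ⊗ 1`, i.e. multiplication of Heisenberg matrices. -/
noncomputable def comulHom :
    HeisenbergAlgebra k →ₐ[k] HeisenbergAlgebra k ⊗[k] HeisenbergAlgebra k :=
  lift k (1 ⊗ₜ[k] x k + x k ⊗ₜ[k] 1) (1 ⊗ₜ[k] y k + y k ⊗ₜ[k] 1)
    (1 ⊗ₜ[k] z k + x k ⊗ₜ[k] y k + z k ⊗ₜ[k] 1)

/-- The counit `x, y, z ↦ 0`, i.e. the identity matrix. -/
noncomputable def counitHom : HeisenbergAlgebra k →ₐ[k] k := lift k 0 0 0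

/-- The antipode `x ↦ -x`, `y ↦ -y`, `z ↦ x y - z`, i.e. inversion of Heisenberg matrices. -/
noncomputable def antipodeHom : HeisenbergAlgebra k →ₐ[k] HeisenbergAlgebra k :=
  lift k (-x k) (-y k) (x k * y k - z k)

/-- The bialgebra structure on `k[x, y, z]` that represents the Heisenberg group. -/
noncomputable instance instBialgebra : Bialgebra k (HeisenbergAlgebra k) :=
  Bialgebra.ofAlgHom (comulHom k) (counitHom k)
    (by
      apply hom_ext <;>
        simp [comulHom, TensorProduct.tmul_add, TensorProduct.add_tmul,
          Algebra.TensorProduct.one_def] <;> abel)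
    (by apply hom_ext <;> simp [comulHom, counitHom])
    (by apply hom_ext <;> simp [comulHom, counitHom])

/-- The Hopf algebra `k[x, y, z]` that represents the Heisenberg group. -/
noncomputable instance instHopfAlgebra : HopfAlgebra k (HeisenbergAlgebra k) :=
  HopfAlgebra.ofAlgHom (antipodeHom k)
    (by
      change (Algebra.TensorProduct.lift (antipodeHom k) (.id k _)
        (fun _ _ => Commute.all _ _)).comp (comulHom k) = (Algebra.ofId k _).comp (counitHom k)
      apply hom_ext <;> simp [comulHom, counitHom, antipodeHom]
      ring)
    (by
      change (Algebra.TensorProduct.lift (.id k _) (antipodeHom k)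
        (fun _ _ => Commute.all _ _)).comp (comulHom k) = (Algebra.ofId k _).comp (counitHom k)
      apply hom_ext <;> simp [comulHom, counitHom, antipodeHom]
      ring)

end HeisenbergAlgebra

/-- A right comodule structure on `V` over a coalgebra `A`. For the coordinate Hopf algebra `A` of
an affine group scheme this is a representation of the group scheme on `V`. -/
structure RightComodule (k A V : Type*) [CommSemiring k] [AddCommMonoid A] [Module k A]
    [Coalgebra k A] [AddCommMonoid V] [Module k V] where
  /-- The coaction. -/
  coact : V →ₗ[k] V ⊗[k] A
  /-- `(1 ⊗ Δ) ∘ ρ = (ρ ⊗ 1) ∘ ρ`. -/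
  coassoc : (Coalgebra.comul (R := k) (A := A)).lTensor V ∘ₗ coact =
    (TensorProduct.assoc k V A A).toLinearMap ∘ₗ coact.rTensor A ∘ₗ coact
  /-- `(1 ⊗ ε) ∘ ρ` is the canonical isomorphism `V ≅ V ⊗ k`. -/
  counit : (Coalgebra.counit (R := k) (A := A)).lTensor V ∘ₗ coact =
    (TensorProduct.rid k V).symm.toLinearMap

/-- A representation of the Heisenberg group scheme over `k` on the vector space `V`. -/
abbrev HeisenbergRep (k V : Type*) [Field k] [AddCommGroup V] [Module k V] : Type _ :=
  RightComodule k (HeisenbergAlgebra k) V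

/-- `a` is the matrix formula of the comodule `M` in the basis `b`: `ρ (e_j) = ∑ i, e_i ⊗ a_ij`. -/
def RightComodule.HasMatrix {k A V : Type*} [CommSemiring k] [AddCommMonoid A] [Module k A]
    [Coalgebra k A] [AddCommMonoid V] [Module k V] {d : ℕ} (M : RightComodule k A V)
    (b : Module.Basis (Fin d) k V) (a : Matrix (Fin d) (Fin d) A) : Prop :=
  ∀ j, M.coact (b j) = ∑ i, b i ⊗ₜ[k] a i j

/-- The exponential series `∑ aⁿ / n!` of a nilpotent element of a `k`-algebra, summed over the `n`
with `aⁿ ≠ 0`. It is meaningful when `a` is nilpotent and `n!` is invertible in `k` for these `n`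
(compare `IsNilpotent.exp`, which is restricted to `ℚ`-algebras). -/
noncomputable def nilExp (k : Type*) {B : Type*} [Field k] [Ring B] [Algebra k B] (a : B) : B :=
  ∑ n ∈ Finset.range (nilpotencyClass a), (n.factorial : k)⁻¹ • a ^ n

/-- A finite family of nilpotent `d × d` matrices `X_i, Y_i, Z_i` with `[X_i, Y_i] = Z_i`,
`[Z_i, X_i] = [Z_i, Y_i] = 0`, such that matrices of different indices commute. -/
structure IsHeisenbergFamily {k ι : Type*} [Field k] {d : ℕ}
    (X Y Z : ι → Matrix (Fin d) (Fin d) k) : Prop where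
  nilpotent_X : ∀ i, IsNilpotent (X i)
  nilpotent_Y : ∀ i, IsNilpotent (Y i)
  nilpotent_Z : ∀ i, IsNilpotent (Z i)
  bracket_X_Y : ∀ i, X i * Y i - Y i * X i = Z i
  commute_Z_X : ∀ i, Commute (Z i) (X i)
  commute_Z_Y : ∀ i, Commute (Z i) (Y i)
  commute_of_ne : ∀ i j, i ≠ j → ∀ P ∈ ({X i, Y i, Z i} : Set (Matrix (Fin d) (Fin d) k)),
    ∀ Q ∈ ({X j, Y j, Z j} : Set (Matrix (Fin d) (Fin d) k)), Commute P Q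

/-- The matrix `x^q X + y^q Y + (z^q - x^q y^q / 2) Z` with entries in `k[x, y, z]`. -/
noncomputable def heisenbergExponent {k : Type*} [Field k] {d : ℕ} (q : ℕ)
    (X Y Z : Matrix (Fin d) (Fin d) k) : Matrix (Fin d) (Fin d) (HeisenbergAlgebra k) :=
  let x := HeisenbergAlgebra.x k
  let y := HeisenbergAlgebra.y k
  let z := HeisenbergAlgebra.z k
  x ^ q • X.map (algebraMap k (HeisenbergAlgebra k))
    + y ^ q • Y.map (algebraMap k (HeisenbergAlgebra k))
    + (z ^ q - (2 : k)⁻¹ • (x ^ q * y ^ q)) • Z.map (algebraMap k (HeisenbergAlgebra k))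

/-- The ordered product, over `i = 0, 1, …, m`, of the exponentials of
`x^(p^i) X_i + y^(p^i) Y_i + (z^(p^i) - x^(p^i) y^(p^i) / 2) Z_i`. -/
noncomputable def heisenbergFormula {k : Type*} [Field k] {d : ℕ} (p m : ℕ)
    (X Y Z : Fin (m + 1) → Matrix (Fin d) (Fin d) k) :
    Matrix (Fin d) (Fin d) (HeisenbergAlgebra k) :=
  (List.ofFn fun i : Fin (m + 1) =>
    nilExp k (heisenbergExponent (p ^ (i : ℕ)) (X i) (Y i) (Z i))).prod

/-! A representation is a matrix `a(x, y, z)` of polynomials that is multiplicative on the points of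
the group in every commutative `k`-algebra. As `(x, y, z) = (0, y, 0)(x, 0, 0)(0, 0, z)`, it is
determined by its restrictions to three copies of the additive group. The coefficients `A n` of such
a restriction are divided powers: `A m * A n` is `A (m + n)` times a binomial coefficient. By Lucas'
theorem they are determined by the `A (p ^ i)`, and the restriction is the product of the truncated
exponentials of `u ^ p ^ i • A (p ^ i)` (`IsDividedPowerSeq.sum_pow_smul_eq_prod`). The coefficients
at `p ^ i` are the matrices `X_i`, `Y_i`, `Z_i`.

Their relations come from `(x, 0, 0)(0, y, 0) = (0, y, 0)(x, 0, 0)(0, 0, xy)`, that is, `A m * B n =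
∑ r, B (n - r) * A (m - r) * C r`. For `m = p ^ i`, `n = p ^ j`, a term with `r ≠ 0` other than `r =
p ^ i = p ^ j` contains two divided powers whose indices add up to a power of `p`. That addition
carries, so one index has a base `p` digit at least `p / 2 ≥ d`, and the `d`-th power of a nilpotent
`d × d` matrix is zero (`IsDividedPowerSeq.mul_eq_zero_of_add_eq_pow`). Only the Heisenberg brackets
survive.

Conversely, in a family all monomials of weight at least `d` vanish
(`monomial_eq_zero_of_heisenberg`), so truncated exponentials obey Baker–Campbell–Hausdorff
(`pow_eq_zero_and_truncExp_add`) and each factor respects the group law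
(`IsHeisenbergTriple.heisenbergExp_mul`). Frobenius is a ring homomorphism and different factors
commute, so the product respects it too; at the generic pair of points this is the comodule
identity. -/

/-! ### Truncated exponentials and the Baker–Campbell–Hausdorff formula. -/

/-- The exponential series truncated below degree `p`. -/
noncomputable def truncExp (k : Type*) {R : Type*} [Field k] [Ring R] [Algebra k R] (p : ℕ)
    (a : R) : R :=
  ∑ n ∈ Finset.range p, (n.factorial : k)⁻¹ • a ^ n

section truncExp

variable {k R : Type*} [Field k] [Ring R] [Algebra k R] {p : ℕ}

theorem nilExp_eq_truncExp {a : R} (ha : a ^ p = 0) : nilExp k a = truncExp k p a := by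
  have hle : nilpotencyClass a ≤ p := Nat.sInf_le ha
  refine Finset.sum_subset (Finset.range_mono hle) fun n _ hn => ?_
  have h0 : a ^ nilpotencyClass a = 0 := pow_nilpotencyClass ⟨p, ha⟩
  rw [pow_eq_zero_of_le (by simpa using hn) h0, smul_zero]

theorem Commute.truncExp {a b : R} (h : Commute a b) :
    Commute (truncExp k p a) (truncExp k p b) :=
  Commute.sum_left _ _ _ fun m _ => Commute.sum_right _ _ _ fun n _ =>
    ((h.pow_pow m n).smul_left _).smul_right _

theorem truncExp_zero (hp : p ≠ 0) : truncExp k p (0 : R) = 1 := by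
  obtain ⟨q, rfl⟩ := Nat.exists_eq_succ_of_ne_zero hp
  simp [_root_.truncExp, Finset.sum_range_succ']

theorem natCast_factorial_ne_zero [Fact p.Prime] [CharP k p] {n : ℕ} (hn : n < p) :
    (n.factorial : k) ≠ 0 := by
  rw [Ne, CharP.cast_eq_zero_iff k p, (Fact.out : p.Prime).dvd_factorial]
  omega

open Polynomial in
/-- The generating polynomial of `truncExp`. -/
noncomputable def truncExpPoly (k : Type*) {R : Type*} [Field k] [Ring R] [Algebra k R]
    (p e : ℕ) (a : R) : R[X] :=
  ∑ n ∈ Finset.range p, monomial (e * n) ((n.factorial : k)⁻¹ • a ^ n)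

theorem smul_inv_factorial_succ [Fact p.Prime] [CharP k p] {a : R} (ha : a ^ p = 0) (n : ℕ) :
    ((n + 1).factorial : k)⁻¹ • a ^ (n + 1) * ((n + 1 : ℕ) : R)
      = a * ((n.factorial : k)⁻¹ • a ^ n) := by
  rcases lt_or_ge (n + 1) p with h | h
  · have h1 : ((n + 1 : ℕ) : k) ≠ 0 := by
      have := natCast_factorial_ne_zero (k := k) h
      rw [Nat.factorial_succ, Nat.cast_mul] at this
      exact left_ne_zero_of_mul this
    have h2 : ((n + 1 : ℕ) : R) = algebraMap k R ((n + 1 : ℕ) : k) := by simp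
    rw [h2, ← Algebra.commutes, ← Algebra.smul_def, smul_smul, Nat.factorial_succ, Nat.cast_mul,
      mul_inv, mul_inv_cancel_left₀ h1, mul_smul_comm, pow_succ']
  · have h0 : a ^ (n + 1) = 0 := pow_eq_zero_of_le h ha
    rw [mul_smul_comm, ← pow_succ', h0]
    simp

open Polynomial in
theorem truncExpPoly_eq_sum_succ {a : R} (ha : a ^ p = 0) (e : ℕ) :
    truncExpPoly k p e a
      = ∑ n ∈ Finset.range (p + 1), monomial (e * n) ((n.factorial : k)⁻¹ • a ^ n) := by
  rw [Finset.sum_range_succ, ha, smul_zero, map_zero, add_zero, truncExpPoly]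

open Polynomial in
theorem derivative_truncExpPoly [Fact p.Prime] [CharP k p] {a : R} (ha : a ^ p = 0) (e : ℕ) :
    derivative (truncExpPoly k p (e + 1) a)
      = (e + 1 : R[X]) * X ^ e * C a * truncExpPoly k p (e + 1) a := by
  have hterm : ∀ n, derivative (monomial ((e + 1) * (n + 1))
      (((n + 1).factorial : k)⁻¹ • a ^ (n + 1)))
      = (e + 1 : R[X]) * X ^ e * C a * monomial ((e + 1) * n) ((n.factorial : k)⁻¹ • a ^ n) := by
    intro n
    have h1 : ((e + 1 : R[X]) * X ^ e) = monomial e ((e + 1 : ℕ) : R) := by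
      rw [← C_mul_X_pow_eq_monomial]; simp
    rw [derivative_monomial, h1, mul_assoc, C_mul_monomial, monomial_mul_monomial]
    congr 1
    · rw [show (e + 1) * (n + 1) - 1 = e + (e + 1) * n by rw [Nat.mul_succ]; omega]
    · rw [← smul_inv_factorial_succ ha, Nat.cast_mul, (Nat.cast_commute (e + 1) _).eq, ← mul_assoc,
        (Nat.cast_commute (e + 1) _).eq, mul_assoc]
  conv_lhs => rw [truncExpPoly_eq_sum_succ ha, Finset.sum_range_succ', derivative_add,
    derivative_sum, Finset.sum_congr rfl fun n _ => hterm n]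
  rw [truncExpPoly, Finset.mul_sum]
  simp

theorem mul_pow_eq_of_commutator {X Y Z : R} (h : X * Y - Y * X = Z) (hZY : Commute Z Y) (n : ℕ) :
    X * Y ^ n = Y ^ n * X + n * (Z * Y ^ (n - 1)) := by
  induction n with
  | zero => simp
  | succ n ih =>
    have hXY : X * Y = Y * X + Z := by rw [← h]; abel
    rw [pow_succ, ← mul_assoc, ih, add_mul, mul_assoc, hXY]
    rcases n with _ | n
    · simp
    · simp only [Nat.add_sub_cancel, mul_assoc, ← pow_succ, mul_add]
      have : Y ^ (n + 1) * Z = Z * Y ^ (n + 1) := (hZY.pow_right _).eq.symm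
      rw [this]
      push_cast
      noncomm_ring

/-- The exponent `p - 1` is needed at `n + 1 = p`, where the last term still contains `B ^ (p - 1)`.
-/
theorem commutator_smul_inv_factorial [Fact p.Prime] [CharP k p] {A B D : R}
    (h : A * B - B * A = D) (hDB : Commute D B) (hB : B ^ (p - 1) = 0) (n : ℕ) :
    A * (((n + 1).factorial : k)⁻¹ • B ^ (n + 1))
      = ((n + 1).factorial : k)⁻¹ • B ^ (n + 1) * A + D * ((n.factorial : k)⁻¹ • B ^ n) := by
  rcases lt_or_ge (n + 1) p with hn | hn
  · have h1 : ((n + 1 : ℕ) : k) ≠ 0 := by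
      have := natCast_factorial_ne_zero (k := k) hn
      rw [Nat.factorial_succ, Nat.cast_mul] at this
      exact left_ne_zero_of_mul this
    have h2 : ((n + 1 : ℕ) : R) = algebraMap k R ((n + 1 : ℕ) : k) := by simp
    rw [mul_smul_comm, mul_pow_eq_of_commutator h hDB, smul_add, smul_mul_assoc, mul_smul_comm,
      h2, ← Algebra.smul_def, smul_smul, Nat.factorial_succ, Nat.cast_mul, mul_inv,
      mul_right_comm, inv_mul_cancel₀ h1, one_mul, Nat.add_sub_cancel]
  · rw [pow_eq_zero_of_le (by omega) hB, pow_eq_zero_of_le (by omega) hB]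
    simp

open Polynomial in
theorem C_mul_truncExpPoly_one [Fact p.Prime] [CharP k p] {A B D : R} (h : A * B - B * A = D)
    (hDB : Commute D B) (hB : B ^ (p - 1) = 0) :
    C A * truncExpPoly k p 1 B
      = truncExpPoly k p 1 B * C A + X * C D * truncExpPoly k p 1 B := by
  have hterm : ∀ n : ℕ, C A * monomial (1 * (n + 1)) (((n + 1).factorial : k)⁻¹ • B ^ (n + 1))
      = monomial (1 * (n + 1)) (((n + 1).factorial : k)⁻¹ • B ^ (n + 1)) * C A
        + X * C D * monomial (1 * n) ((n.factorial : k)⁻¹ • B ^ n) := by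
    intro n
    rw [C_mul_monomial, commutator_smul_inv_factorial h hDB hB, monomial_mul_C, mul_assoc,
      C_mul_monomial, X_mul_monomial, map_add]
    simp only [one_mul]
  have hBp : B ^ p = 0 := pow_eq_zero_of_le (by omega) hB
  have hsum := truncExpPoly_eq_sum_succ (k := k) hBp 1
  rw [Finset.sum_range_succ'] at hsum
  conv_lhs => rw [hsum, mul_add, Finset.mul_sum, Finset.sum_congr rfl fun n _ => hterm n,
    Finset.sum_add_distrib]
  conv_rhs => rw [hsum, add_mul, Finset.sum_mul, ← hsum, truncExpPoly, Finset.mul_sum]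
  have h0 : C A * monomial 0 (1 : R) = monomial 0 1 * C A := by simp
  simp only [mul_zero, pow_zero, Nat.factorial_zero, Nat.cast_one, inv_one, one_smul, h0]
  abel

open Polynomial in
theorem C_commute_truncExpPoly {a b : R} (h : Commute a b) (e : ℕ) :
    Commute (C a) (truncExpPoly k p e b) := by
  refine Commute.sum_right _ _ _ fun n _ => ?_
  rw [Commute, SemiconjBy, C_mul_monomial, monomial_mul_C]
  congr 1
  exact ((h.pow_right n).smul_right _).eq

open Polynomial in
-- Differentiating the middle factor puts `P` to the right of the series of `Q`. Moving it to the
-- front costs `-2TW`, which cancels the derivative of the series of `W` in `T ^ 2`.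
theorem derivative_truncExpPoly_mul [Fact p.Prime] [CharP k p] {P Q W : R}
    (h : P * Q - Q * P = W + W) (hWP : Commute W P) (hWQ : Commute W Q)
    (hP : P ^ p = 0) (hQ : Q ^ (p - 1) = 0) (hW : W ^ p = 0) :
    derivative (truncExpPoly k p 1 Q * truncExpPoly k p 1 P * truncExpPoly k p 2 W)
      = C (P + Q) * (truncExpPoly k p 1 Q * truncExpPoly k p 1 P * truncExpPoly k p 2 W) := by
  have hQp : Q ^ p = 0 := pow_eq_zero_of_le (by omega) hQ
  have d1 := derivative_truncExpPoly (k := k) hQp 0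
  have d2 := derivative_truncExpPoly (k := k) hP 0
  have d3 := derivative_truncExpPoly (k := k) hW 1
  have hc := C_mul_truncExpPoly_one (k := k) h (hWQ.add_left hWQ) hQ
  have cQ := C_commute_truncExpPoly (k := k) (p := p) hWQ 1
  have cP := C_commute_truncExpPoly (k := k) (p := p) hWP 1
  simp only [Nat.cast_zero, zero_add, pow_zero, one_mul, Nat.cast_one, pow_one,
    Nat.reduceAdd] at d1 d2 d3
  rw [derivative_mul, derivative_mul, d1, d2, d3]
  set E := truncExpPoly k p 1 Q
  set F := truncExpPoly k p 1 P
  set G := truncExpPoly k p 2 W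
  have e1 : E * (C P * F) * G = (E * C P) * F * G := by noncomm_ring
  have e2 : E * C P = C P * E - X * C (W + W) * E := by rw [hc]; abel
  have hX : Commute (E * F) ((1 + 1) * X) :=
    ((Commute.one_right _).add_right (Commute.one_right _)).mul_right (X_mul (p := E * F)).symm
  have e3 : E * F * ((1 + 1) * X * C W * G) = (1 + 1) * (X * (E * F * C W * G)) := by
    rw [mul_assoc ((1 + 1) * X), ← mul_assoc (E * F), hX.eq]
    noncomm_ring
  have e4 : E * F * C W = C W * E * F := by
    rw [mul_assoc, ← cP.eq, ← mul_assoc, cQ.eq]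
  rw [add_mul, e1, e2, e3, e4, C_add, C_add]
  noncomm_ring

open Polynomial in
theorem truncExpPoly_coeff_zero (hp : p ≠ 0) {e : ℕ} (he : e ≠ 0) (a : R) :
    (truncExpPoly k p e a).coeff 0 = 1 := by
  obtain ⟨q, rfl⟩ := Nat.exists_eq_succ_of_ne_zero hp
  rw [truncExpPoly, finsetSum_coeff, Finset.sum_range_succ', Finset.sum_eq_zero]
  · simp
  · intro n _
    rw [coeff_monomial, if_neg (by positivity)]

open Polynomial in
theorem truncExpPoly_mul_eq_sum (P Q W : R) :
    truncExpPoly k p 1 Q * truncExpPoly k p 1 P * truncExpPoly k p 2 W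
      = ∑ a ∈ Finset.range p, ∑ b ∈ Finset.range p, ∑ c ∈ Finset.range p,
        monomial (a + b + 2 * c) (((a.factorial : k)⁻¹ * (b.factorial : k)⁻¹ *
          (c.factorial : k)⁻¹) • (Q ^ a * P ^ b * W ^ c)) := by
  rw [truncExpPoly, truncExpPoly, truncExpPoly, Finset.sum_mul_sum, Finset.sum_mul]
  refine Finset.sum_congr rfl fun a _ => ?_
  rw [Finset.sum_mul]
  refine Finset.sum_congr rfl fun b _ => ?_
  rw [Finset.mul_sum]
  simp only [monomial_mul_monomial, one_mul, smul_mul_smul_comm]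

open Polynomial in
/-- The Baker–Campbell–Hausdorff formula for truncated exponentials in characteristic `p`. -/
theorem pow_eq_zero_and_truncExp_add [Fact p.Prime] [CharP k p] {P Q W : R} {d : ℕ} (hd : d < p)
    (h : P * Q - Q * P = W + W) (hWP : Commute W P) (hWQ : Commute W Q)
    (hmon : ∀ a b c, d ≤ a + b + 2 * c → Q ^ a * P ^ b * W ^ c = 0) :
    (P + Q) ^ d = 0 ∧
      truncExp k p (P + Q) = truncExp k p Q * truncExp k p P * truncExp k p W := by
  have hp0 : p ≠ 0 := (Fact.out : p.Prime).ne_zero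
  have hQ : Q ^ (p - 1) = 0 := by simpa using hmon (p - 1) 0 0 (by omega)
  have hP : P ^ p = 0 := by simpa using hmon 0 p 0 (by omega)
  have hW : W ^ p = 0 := by simpa using hmon 0 0 p (by omega)
  set F := truncExpPoly k p 1 Q * truncExpPoly k p 1 P * truncExpPoly k p 2 W with hF
  have hder : derivative F = C (P + Q) * F := derivative_truncExpPoly_mul h hWP hWQ hP hQ hW
  have hsum := truncExpPoly_mul_eq_sum (k := k) (p := p) P Q W
  rw [← hF] at hsum
  -- Since `W` carries `T ^ 2`, the degree in `T` is the weight that `hmon` bounds.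
  have hvan : ∀ n, d ≤ n → F.coeff n = 0 := by
    intro n hn
    rw [hsum]
    simp only [finsetSum_coeff, coeff_monomial]
    refine Finset.sum_eq_zero fun a _ => Finset.sum_eq_zero fun b _ =>
      Finset.sum_eq_zero fun c _ => ?_
    split_ifs with hs
    · rw [hmon a b c (by omega), smul_zero]
    · rfl
  -- The differential equation with constant term `1` fixes the coefficients recursively, as long as
  -- one divides by integers below `p`.
  have hcoeff : ∀ n, n < p → F.coeff n = (n.factorial : k)⁻¹ • (P + Q) ^ n := by
    intro n
    induction n with
    | zero =>
      intro _
      simp [hF, mul_coeff_zero, truncExpPoly_coeff_zero hp0]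
    | succ n ih =>
      intro hn
      have h1 : ((n + 1 : ℕ) : k) ≠ 0 := by
        have := natCast_factorial_ne_zero (k := k) hn
        rw [Nat.factorial_succ, Nat.cast_mul] at this
        exact left_ne_zero_of_mul this
      have h2 := congrArg (fun G => G.coeff n) hder
      simp only [coeff_derivative, coeff_C_mul] at h2
      rw [ih (by omega)] at h2
      have h3 : ((n : R) + 1) = algebraMap k R ((n + 1 : ℕ) : k) := by simp
      rw [h3, ← Algebra.commutes, ← Algebra.smul_def, mul_smul_comm, ← pow_succ'] at h2
      rw [Nat.factorial_succ, Nat.cast_mul, mul_inv, mul_smul, ← h2, smul_smul,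
        inv_mul_cancel₀ h1, one_smul]
  refine ⟨?_, ?_⟩
  -- In degree `d` both descriptions apply: `(P + Q) ^ d / d!` is zero, and `d!` is invertible.
  · have h1 := hcoeff d hd
    rw [hvan d le_rfl] at h1
    exact ((smul_eq_zero_iff_right (inv_ne_zero (natCast_factorial_ne_zero hd))).1 h1.symm)
  · have hdeg : F.natDegree < p := by
      refine lt_of_le_of_lt (b := p - 1) ?_ (by omega)
      rw [natDegree_le_iff_coeff_eq_zero]
      exact fun n hn => hvan n (by omega)
    have h1 : F.eval 1 = truncExp k p (P + Q) := by
      rw [eval_eq_sum_range' hdeg, truncExp]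
      refine Finset.sum_congr rfl fun n hn => ?_
      rw [hcoeff n (Finset.mem_range.1 hn), one_pow, mul_one]
    rw [← h1, hsum]
    rw [truncExp, truncExp, truncExp, Finset.sum_mul_sum, Finset.sum_mul, eval_finsetSum]
    refine Finset.sum_congr rfl fun a _ => ?_
    rw [Finset.sum_mul, eval_finsetSum]
    refine Finset.sum_congr rfl fun b _ => ?_
    rw [Finset.mul_sum, eval_finsetSum]
    simp only [eval_monomial, one_pow, mul_one, smul_mul_smul_comm]

/-- Additivity of the truncated exponential on commuting elements. -/
theorem truncExp_add_of_commute [Fact p.Prime] [CharP k p] {P Q : R} {m n : ℕ} (hmn : m + n ≤ p)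
    (h : Commute P Q) (hP : P ^ m = 0) (hQ : Q ^ n = 0) :
    truncExp k p (P + Q) = truncExp k p P * truncExp k p Q := by
  rcases subsingleton_or_nontrivial R with hR | hR
  · exact Subsingleton.elim _ _
  have hm : m ≠ 0 := by rintro rfl; simp at hP
  have hn : n ≠ 0 := by rintro rfl; simp at hQ
  -- The bound `p - 1` suffices: `a + b ≥ p - 1 ≥ m + n - 1` forces `a ≥ m` or `b ≥ n`.
  have h1 := (pow_eq_zero_and_truncExp_add (k := k) (W := 0) (d := p - 1) (P := Q) (Q := P)
    (by omega) (by rw [h.eq]; simp) (Commute.zero_left _) (Commute.zero_left _) ?_).2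
  · rw [add_comm, h1, truncExp_zero (by omega), mul_one]
  · intro a b c habc
    rcases c with _ | c
    · rcases lt_or_ge a m with ha | ha
      · rw [pow_eq_zero_of_le (m := n) (by omega) hQ]; simp
      · rw [pow_eq_zero_of_le ha hP]; simp
    · simp

end truncExp

/-! ### Divided power sequences in characteristic `p`. -/

/-- A sequence of divided powers: `A m * A n = (m + n choose m) • A (m + n)` and `A 0 = 1`. -/
structure IsDividedPowerSeq {R : Type*} [Ring R] (A : ℕ → R) : Prop where
  zero : A 0 = 1
  mul : ∀ m n, A m * A n = (m + n).choose m • A (m + n)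

namespace IsDividedPowerSeq

variable {k R : Type*} [Field k] [Ring R] [Algebra k R] {p : ℕ} {A : ℕ → R}

theorem nsmul_eq_of_modEq [CharP k p] {m n : ℕ} (h : m ≡ n [MOD p]) (a : R) :
    m • a = n • a := by
  rw [← Nat.cast_smul_eq_nsmul k, ← Nat.cast_smul_eq_nsmul k n,
    (CharP.natCast_eq_natCast' k p h)]

protected theorem commute (hA : IsDividedPowerSeq A) (m n : ℕ) : Commute (A m) (A n) := by
  rw [Commute, SemiconjBy, hA.mul, hA.mul, add_comm n m, ← Nat.choose_symm_add]

theorem comp_mul [Fact p.Prime] [CharP k p] (hA : IsDividedPowerSeq A) :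
    IsDividedPowerSeq fun n => A (p * n) where
  zero := by simpa using hA.zero
  mul m n := by
    have hp := (Fact.out : p.Prime).pos
    rw [hA.mul, ← mul_add]
    refine nsmul_eq_of_modEq (k := k) (p := p) ?_ _
    simpa [hp] using Choose.choose_modEq_choose_mod_mul_choose_div_nat (p := p)
      (n := p * (m + n)) (k := p * m)

theorem comp_pow_mul [Fact p.Prime] [CharP k p] (hA : IsDividedPowerSeq A) (i : ℕ) :
    IsDividedPowerSeq fun n => A (p ^ i * n) := by
  induction i with
  | zero => simpa using hA
  | succ i ih => simpa [pow_succ, mul_assoc] using ih.comp_mul (k := k) (p := p)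

/-- By Lucas, `(j + p * n).choose j` is `1` modulo `p`, so the lowest base `p` digit splits off. -/
theorem apply_add_mul [Fact p.Prime] [CharP k p] (hA : IsDividedPowerSeq A) {j : ℕ} (hj : j < p)
    (n : ℕ) : A (j + p * n) = A j * A (p * n) := by
  have hp := (Fact.out : p.Prime).pos
  rw [hA.mul]
  conv_lhs => rw [← one_smul ℕ (A _)]
  refine nsmul_eq_of_modEq (k := k) (p := p) ?_ _
  simpa [Nat.mod_eq_of_lt hj, Nat.div_eq_of_lt hj] using
    (Choose.choose_modEq_choose_mod_mul_choose_div_nat (p := p) (n := j + p * n) (k := j)).symm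

theorem pow_apply_one (hA : IsDividedPowerSeq A) (n : ℕ) : A 1 ^ n = n.factorial • A n := by
  induction n with
  | zero => simp [hA.zero]
  | succ n ih =>
    rw [pow_succ, ih, smul_mul_assoc, hA.mul, smul_smul, Nat.factorial_succ, mul_comm (n + 1)]
    simp

theorem pow_char_eq_zero [Fact p.Prime] [CharP k p] (hA : IsDividedPowerSeq A) :
    A 1 ^ p = 0 := by
  rw [hA.pow_apply_one, nsmul_eq_of_modEq (k := k) (p := p) (n := 0), zero_smul]
  exact (Nat.modEq_zero_iff_dvd).2 (Nat.dvd_factorial (Fact.out : p.Prime).pos le_rfl)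

theorem eq_inv_factorial_smul [Fact p.Prime] [CharP k p] (hA : IsDividedPowerSeq A) {n : ℕ}
    (hn : n < p) : A n = (n.factorial : k)⁻¹ • A 1 ^ n := by
  rw [hA.pow_apply_one, ← Nat.cast_smul_eq_nsmul k, smul_smul,
    inv_mul_cancel₀ (natCast_factorial_ne_zero hn), one_smul]

theorem eq_zero_of_le [Fact p.Prime] [CharP k p] (hA : IsDividedPowerSeq A) {d n : ℕ}
    (hd : A 1 ^ d = 0) (hdn : d ≤ n) (hn : n < p) : A n = 0 := by
  rw [hA.eq_inv_factorial_smul (k := k) hn, pow_eq_zero_of_le hdn hd, smul_zero]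

/-- If `p` does not divide `n`, the last digits of `n` and `r` add up to at least `p ≥ 2 * d`, so
one of them is at least `d` and its divided power is zero. Otherwise both indices are divisible by
`p`, and the induction passes to the sequences `B (p * ·)` and `C (p * ·)`; hence the quantification
over `B` and `C` inside. -/
theorem mul_eq_zero_of_add_eq_pow [Fact p.Prime] [CharP k p] {d : ℕ} (hd : 2 * d ≤ p) (j : ℕ) :
    ∀ {B C : ℕ → R}, IsDividedPowerSeq B → IsDividedPowerSeq C →
      (∀ i, B (p ^ i) ^ d = 0) → (∀ i, C (p ^ i) ^ d = 0) →
      ∀ {n r : ℕ}, n ≠ 0 → r ≠ 0 → n + r = p ^ j → B n * C r = 0 := by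
  have hp := (Fact.out : p.Prime).pos
  induction j with
  | zero => intro B C _ _ _ _ n r hn hr h; rw [pow_zero] at h; omega
  | succ j ih =>
    intro B C hB hC hBd hCd n r hn hr h
    have hn' := Nat.mod_add_div n p
    have hr' := Nat.mod_add_div r p
    have hnp := Nat.mod_lt n hp
    have hrp := Nat.mod_lt r hp
    by_cases hdvd : n % p = 0
    · have hdvd' : r % p = 0 := by
        have h1 : p ∣ n + r := h ▸ dvd_pow_self p (Nat.succ_ne_zero j)
        exact Nat.mod_eq_zero_of_dvd ((Nat.dvd_add_right (Nat.dvd_of_mod_eq_zero hdvd)).1 h1)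
      rw [hdvd, zero_add] at hn'
      rw [hdvd', zero_add] at hr'
      rw [← hn', ← hr']
      refine ih (hB.comp_mul (k := k)) (hC.comp_mul (k := k)) (fun i => ?_) (fun i => ?_) ?_ ?_ ?_
      · simpa only [← pow_succ'] using hBd (i + 1)
      · simpa only [← pow_succ'] using hCd (i + 1)
      · rintro h0; simp [h0] at hn'; omega
      · rintro h0; simp [h0] at hr'; omega
      · apply Nat.eq_of_mul_eq_mul_left hp
        rw [mul_add, hn', hr', h, pow_succ']
    · have hsum : p ≤ n % p + r % p := by
        have h1 : p ∣ n % p + r % p := by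
          rw [Nat.dvd_iff_mod_eq_zero, ← Nat.add_mod, h, pow_succ]; simp
        exact Nat.le_of_dvd (by omega) h1
      rw [← hn', ← hr', hB.apply_add_mul (k := k) hnp, hC.apply_add_mul (k := k) hrp]
      rcases le_or_gt d (n % p) with h1 | h1
      · rw [hB.eq_zero_of_le (k := k) (by simpa using hBd 0) h1 hnp]; simp
      · rw [hC.eq_zero_of_le (k := k) (by simpa using hCd 0) (by omega : d ≤ r % p) hrp]; simp

end IsDividedPowerSeq

/-! ### Factorization of generating series over base `p` digits. -/

theorem Finset.sum_range_mul_eq {M : Type*} [AddCommMonoid M] (f : ℕ → M) (p N : ℕ) :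
    ∑ n ∈ Finset.range (p * N), f n
      = ∑ l ∈ Finset.range N, ∑ j ∈ Finset.range p, f (j + p * l) := by
  induction N with
  | zero => simp
  | succ N ih =>
    rw [Nat.mul_succ, Finset.sum_range_add, ih, Finset.sum_range_succ]
    simp only [add_comm]

theorem List.commute_prod_ofFn {R : Type*} [Monoid R] {n : ℕ} {a : R} {f : Fin n → R}
    (h : ∀ i, Commute a (f i)) : Commute a (List.ofFn f).prod :=
  Commute.list_prod_right _ _ fun x hx => by
    obtain ⟨i, rfl⟩ := List.mem_ofFn.1 hx
    exact h i

theorem List.prod_ofFn_mul_distrib {R : Type*} [Monoid R] {n : ℕ} {f g : Fin n → R}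
    (h : ∀ i j, i ≠ j → Commute (f i) (g j)) :
    (List.ofFn fun i => f i * g i).prod = (List.ofFn f).prod * (List.ofFn g).prod := by
  induction n with
  | zero => simp
  | succ n ih =>
    simp only [List.ofFn_succ, List.prod_cons]
    rw [ih fun i j hij => h _ _ fun e => hij (Fin.succ_injective _ e)]
    have h1 : Commute (g 0) (List.ofFn fun i : Fin n => f i.succ).prod :=
      List.commute_prod_ofFn fun i => (h _ _ (Fin.succ_ne_zero i)).symm
    rw [mul_assoc, ← mul_assoc (g 0), h1.eq]
    simp only [mul_assoc]

namespace IsDividedPowerSeq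

variable {k B R : Type*} [Field k] [CommRing B] [Algebra k B] [Ring R] [Algebra k R] [Algebra B R]
  [IsScalarTower k B R] {p : ℕ}

/-- Expanding `n` in base `p` turns the sum into a product over digits. The induction peels off the
lowest digit, whose sum is `truncExp k p (u • A 1)`, and replaces `u` by `u ^ p`. -/
theorem sum_pow_smul_eq_prod [Fact p.Prime] [CharP k p] (m : ℕ) :
    ∀ {A : ℕ → R}, IsDividedPowerSeq A → ∀ u : B,
      ∑ n ∈ Finset.range (p ^ m), u ^ n • A n
        = (List.ofFn fun i : Fin m =>
            truncExp k p (u ^ p ^ (i : ℕ) • A (p ^ (i : ℕ)))).prod := by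
  induction m with
  | zero => intro A hA u; simp [hA.zero]
  | succ m ih =>
    intro A hA u
    have h0 : truncExp k p (u • A 1) = ∑ j ∈ Finset.range p, u ^ j • A j := by
      refine Finset.sum_congr rfl fun j hj => ?_
      rw [hA.eq_inv_factorial_smul (k := k) (Finset.mem_range.1 hj), smul_pow, smul_comm]
    have h1 := ih (hA.comp_mul (k := k) (p := p)) (u ^ p)
    rw [List.ofFn_succ, List.prod_cons]
    simp only [Fin.val_zero, Fin.val_succ, pow_zero, pow_one]
    simp only [← pow_mul, ← pow_succ'] at h1
    rw [← h1, h0, pow_succ', Finset.sum_range_mul_eq, Finset.sum_mul_sum, Finset.sum_comm]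
    refine Finset.sum_congr rfl fun j hj => Finset.sum_congr rfl fun l _ => ?_
    rw [hA.apply_add_mul (k := k) (Finset.mem_range.1 hj), pow_add, smul_mul_smul_comm]

end IsDividedPowerSeq

/-! ### Vanishing of monomials of weight at least `d`. -/

section Monomials

variable {k : Type*} [Field k] {d : ℕ}

/-- The span of the vectors `Y ^ a * X ^ b * Z ^ c * w` of weight `a + b + 2 * c ≥ n`. -/
def weightFiltration (X Y Z : Matrix (Fin d) (Fin d) k) (n : ℕ) : Submodule k (Fin d → k) :=
  Submodule.span k {v | ∃ a b c w, n ≤ a + b + 2 * c ∧ v = (Y ^ a * X ^ b * Z ^ c).mulVec w}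

variable {X Y Z : Matrix (Fin d) (Fin d) k}

theorem weightFiltration_antitone : Antitone (weightFiltration X Y Z) := by
  intro m n hmn
  apply Submodule.span_mono
  rintro v ⟨a, b, c, w, h, rfl⟩
  exact ⟨a, b, c, w, hmn.trans h, rfl⟩

theorem mulVec_mem_weightFiltration {a b c n : ℕ} (h : n ≤ a + b + 2 * c) (w : Fin d → k) :
    (Y ^ a * X ^ b * Z ^ c).mulVec w ∈ weightFiltration X Y Z n :=
  Submodule.subset_span ⟨a, b, c, w, h, rfl⟩

theorem weightFiltration_le_comap_Y (n : ℕ) :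
    weightFiltration X Y Z n ≤ (weightFiltration X Y Z (n + 1)).comap Y.mulVecLin := by
  refine Submodule.span_le.2 ?_
  rintro v ⟨a, b, c, w, h, rfl⟩
  simp only [Submodule.comap_coe, Set.mem_preimage, Matrix.mulVecLin_apply, SetLike.mem_coe,
    Matrix.mulVec_mulVec]
  rw [← mul_assoc, ← mul_assoc, ← pow_succ']
  exact mulVec_mem_weightFiltration (by omega) w

/-- Moving `X` past `Y ^ a` trades one `Y`, of weight `1`, for one `Z`, of weight `2`, so the
correction also gains weight. -/
theorem weightFiltration_le_comap_X (h : X * Y - Y * X = Z) (hZX : Commute Z X)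
    (hZY : Commute Z Y) (n : ℕ) :
    weightFiltration X Y Z n ≤ (weightFiltration X Y Z (n + 1)).comap X.mulVecLin := by
  refine Submodule.span_le.2 ?_
  rintro v ⟨a, b, c, w, hn, rfl⟩
  simp only [Submodule.comap_coe, Set.mem_preimage, Matrix.mulVecLin_apply, SetLike.mem_coe,
    Matrix.mulVec_mulVec]
  have h1 : X * (Y ^ a * X ^ b * Z ^ c) = Y ^ a * X ^ (b + 1) * Z ^ c
      + (a : k) • (Y ^ (a - 1) * X ^ b * Z ^ (c + 1)) := by
    rw [← mul_assoc, ← mul_assoc, mul_pow_eq_of_commutator h hZY, add_mul, add_mul,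
      mul_assoc (Y ^ a) X, ← pow_succ', (hZY.pow_right (a - 1)).eq, Nat.cast_smul_eq_nsmul,
      nsmul_eq_mul]
    congr 1
    rw [pow_succ' Z]
    simp only [mul_assoc]
    rw [← mul_assoc Z, (hZX.pow_right b).eq, mul_assoc]
  rw [h1, Matrix.add_mulVec, Matrix.smul_mulVec]
  refine add_mem (mulVec_mem_weightFiltration (by omega) w) ?_
  -- For `a = 0` the subtraction `a - 1` is truncated, but the coefficient `a` is zero.
  rcases a with _ | a
  · simp
  · exact Submodule.smul_mem _ _ (mulVec_mem_weightFiltration (by omega) w)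

/-- A monomial in `Z` alone has no leading `X` or `Y`; writing one factor as `X * Y - Y * X` creates
them, and weight `2` makes the loss exactly `1`. -/
theorem weightFiltration_succ_le (h : X * Y - Y * X = Z) (n : ℕ) :
    weightFiltration X Y Z (n + 1) ≤ (weightFiltration X Y Z n).map X.mulVecLin
      ⊔ (weightFiltration X Y Z n).map Y.mulVecLin := by
  refine Submodule.span_le.2 ?_
  rintro v ⟨a, b, c, w, hn, rfl⟩
  rcases a with _ | a
  · rcases b with _ | b
    · rcases c with _ | c
      · omega
      · have h1 : (Y ^ 0 * X ^ 0 * Z ^ (c + 1)).mulVec w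
            = X.mulVec ((Y ^ 1 * X ^ 0 * Z ^ c).mulVec w)
              - Y.mulVec ((Y ^ 0 * X ^ 1 * Z ^ c).mulVec w) := by
          rw [Matrix.mulVec_mulVec, Matrix.mulVec_mulVec, ← Matrix.sub_mulVec, pow_succ' Z]
          congr 1
          rw [← h]
          simp only [pow_zero, pow_one, one_mul, mul_one, sub_mul, mul_assoc]
        rw [h1]
        exact sub_mem
          (Submodule.mem_sup_left ⟨_, mulVec_mem_weightFiltration (by omega) w, rfl⟩)
          (Submodule.mem_sup_right ⟨_, mulVec_mem_weightFiltration (by omega) w, rfl⟩)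
    · refine Submodule.mem_sup_left ⟨(Y ^ 0 * X ^ b * Z ^ c).mulVec w,
        mulVec_mem_weightFiltration (by omega) w, ?_⟩
      rw [Matrix.mulVecLin_apply, Matrix.mulVec_mulVec]
      simp only [pow_zero, one_mul, pow_succ', mul_assoc]
  · refine Submodule.mem_sup_right ⟨(Y ^ a * X ^ b * Z ^ c).mulVec w,
      mulVec_mem_weightFiltration (by omega) w, ?_⟩
    rw [Matrix.mulVecLin_apply, Matrix.mulVec_mulVec]
    simp only [pow_succ', mul_assoc]

/-- Nilpotent matrices `X, Y, Z = [X, Y]` with `Z` central generate a strictly triangular algebra: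
monomials of weight at least `d` vanish. -/
theorem monomial_eq_zero_of_heisenberg (hX : IsNilpotent X) (hY : IsNilpotent Y)
    (hZ : IsNilpotent Z) (h : X * Y - Y * X = Z) (hZX : Commute Z X) (hZY : Commute Z Y)
    {a b c : ℕ} (habc : d ≤ a + b + 2 * c) : Y ^ a * X ^ b * Z ^ c = 0 := by
  obtain ⟨l, hl⟩ := hX
  obtain ⟨m, hm⟩ := hY
  obtain ⟨n, hn⟩ := hZ
  set U := weightFiltration X Y Z with hU
  have hbot : U (l + m + 2 * n) = ⊥ := by
    rw [hU, weightFiltration, Submodule.span_eq_bot]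
    rintro v ⟨a, b, c, w, hw, rfl⟩
    have h0 : Y ^ a * X ^ b * Z ^ c = 0 := by
      rcases le_or_gt m a with h1 | h1
      · rw [pow_eq_zero_of_le h1 hm]; simp
      rcases le_or_gt l b with h2 | h2
      · rw [pow_eq_zero_of_le h2 hl]; simp
      · rw [pow_eq_zero_of_le (by omega : n ≤ c) hn]; simp
    rw [h0, Matrix.zero_mulVec]
  -- Each layer is generated by applying `X` and `Y` to the previous one, so a filtration that
  -- stalls once stalls forever; by `hbot` it is then zero.
  have hstep : ∀ i, U i ≤ U (i + 1) → U (i + 1) ≤ U (i + 2) := by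
    intro i hi
    refine (weightFiltration_succ_le h i).trans (sup_le ?_ ?_)
    · exact Submodule.map_le_iff_le_comap.2
        (hi.trans (weightFiltration_le_comap_X h hZX hZY (i + 1)))
    · exact Submodule.map_le_iff_le_comap.2 (hi.trans (weightFiltration_le_comap_Y (i + 1)))
  have hstable : ∀ i, U i ≤ U (i + 1) → ∀ j, U i ≤ U (i + j) := by
    intro i hi j
    have h1 : ∀ j, U (i + j) ≤ U (i + j + 1) := by
      intro j
      induction j with
      | zero => simpa using hi
      | succ j ih => exact hstep _ ih
    induction j with
    | zero => exact le_rfl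
    | succ j ih => exact ih.trans (h1 j)
  -- Until it reaches zero, the filtration loses at least one dimension per step.
  have hrank : ∀ i, Module.finrank k (U i) ≤ d - i := by
    intro i
    induction i with
    | zero => simpa using Submodule.finrank_le (U 0)
    | succ i ih =>
      by_cases hi : U i ≤ U (i + 1)
      · have h1 : U (i + 1) = ⊥ := by
          rw [eq_bot_iff, ← hbot]
          refine (weightFiltration_antitone (Nat.le_succ i)).trans
            ((hstable i hi (l + m + 2 * n)).trans ?_)
          exact weightFiltration_antitone (by omega)
        rw [h1, finrank_bot]; omega
      · have h1 : U (i + 1) < U i :=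
          lt_of_le_not_ge (weightFiltration_antitone (Nat.le_succ i)) hi
        have h2 := Submodule.finrank_lt_finrank_of_lt h1
        omega
  have hd : U d = ⊥ := by
    have := hrank d
    rw [Nat.sub_self, Nat.le_zero] at this
    exact Submodule.finrank_eq_zero.1 this
  apply Matrix.mulVec_injective
  funext w
  have h1 : (Y ^ a * X ^ b * Z ^ c).mulVec w ∈ U d := mulVec_mem_weightFiltration habc w
  rw [hd, Submodule.mem_bot] at h1
  rw [h1, Matrix.zero_mulVec]

end Monomials

/-! ### Exponentials of a Heisenberg triple and the group law. -/

/-- Elements `X, Y, Z` of a `k`-algebra with `[X, Y] = Z` central, all of whose ordered monomials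
of weight at least `d` vanish, and such that `Z` can be halved. -/
structure IsHeisenbergTriple (k : Type*) {R : Type*} [Field k] [Ring R] [Algebra k R] (d : ℕ)
    (X Y Z : R) : Prop where
  bracket : X * Y - Y * X = Z
  commute_Z_X : Commute Z X
  commute_Z_Y : Commute Z Y
  half : Z = (2 : k)⁻¹ • Z + (2 : k)⁻¹ • Z
  monomial_YX : ∀ a b c, d ≤ a + b + 2 * c → Y ^ a * X ^ b * Z ^ c = 0
  monomial_XY : ∀ a b c, d ≤ a + b + 2 * c → X ^ a * Y ^ b * Z ^ c = 0

/-- The element `e ^ (v Y) * e ^ (u X) * e ^ (w Z)`. -/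
noncomputable def heisenbergExp (k : Type*) {B R : Type*} [Field k] [CommRing B] [Ring R]
    [Algebra k R] [Algebra B R] (p : ℕ) (X Y Z : R) (u v w : B) : R :=
  truncExp k p (v • Y) * truncExp k p (u • X) * truncExp k p (w • Z)

section heisenbergExp

variable {k B R : Type*} [Field k] [CommRing B] [Ring R] [Algebra k R] [Algebra B R] {p d : ℕ}
  {X Y Z : R}

theorem commute_heisenbergExp {X' Y' Z' : R} {u v w u' v' w' : B}
    (h : ∀ P ∈ ({X, Y, Z} : Set R), ∀ Q ∈ ({X', Y', Z'} : Set R), Commute P Q) :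
    Commute (heisenbergExp k p X Y Z u v w) (heisenbergExp k p X' Y' Z' u' v' w') := by
  have h1 : ∀ P ∈ ({X, Y, Z} : Set R), ∀ Q ∈ ({X', Y', Z'} : Set R), ∀ s t : B,
      Commute (truncExp k p (s • P)) (truncExp k p (t • Q)) := fun P hP Q hQ s t =>
    (((h P hP Q hQ).smul_left s).smul_right t).truncExp
  have h2 : ∀ P ∈ ({X, Y, Z} : Set R), ∀ s : B,
      Commute (truncExp k p (s • P)) (heisenbergExp k p X' Y' Z' u' v' w') := fun P hP s =>
    ((h1 P hP _ (by simp) s _).mul_right (h1 P hP _ (by simp) s _)).mul_right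
      (h1 P hP _ (by simp) s _)
  exact ((h2 _ (by simp) _).mul_left (h2 _ (by simp) _)).mul_left (h2 _ (by simp) _)

theorem heisenbergExp_zero (hp : p ≠ 0) : heisenbergExp k p X Y Z (0 : B) 0 0 = 1 := by
  simp [heisenbergExp, truncExp_zero hp]

namespace IsHeisenbergTriple

theorem smul_pow_X (h : IsHeisenbergTriple k d X Y Z) (u : B) : (u • X) ^ d = 0 := by
  have := h.monomial_XY d 0 0 (by omega)
  rw [smul_pow]
  simp_all

theorem smul_pow_Y (h : IsHeisenbergTriple k d X Y Z) (u : B) : (u • Y) ^ d = 0 := by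
  have := h.monomial_XY 0 d 0 (by omega)
  rw [smul_pow]
  simp_all

theorem smul_pow_Z (h : IsHeisenbergTriple k d X Y Z) (u : B) : (u • Z) ^ d = 0 := by
  have := h.monomial_XY 0 0 d (by omega)
  rw [smul_pow]
  simp_all

theorem truncExp_add_smul_Z [Fact p.Prime] [CharP k p] (h : IsHeisenbergTriple k d X Y Z)
    (hd : 2 * d ≤ p) (s t : B) :
    truncExp k p ((s + t) • Z) = truncExp k p (s • Z) * truncExp k p (t • Z) := by
  rw [add_smul]
  exact truncExp_add_of_commute (by omega) (((Commute.refl Z).smul_left s).smul_right t)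
    (h.smul_pow_Z s) (h.smul_pow_Z t)

variable [Algebra k B] [IsScalarTower k B R]

theorem smul_bracket (h : IsHeisenbergTriple k d X Y Z) (u v : B) :
    (u • X) * (v • Y) - (v • Y) * (u • X)
      = ((2 : k)⁻¹ • (u * v)) • Z + ((2 : k)⁻¹ • (u * v)) • Z := by
  have h1 : ((2 : k)⁻¹ • (u * v)) • Z = (u * v) • ((2 : k)⁻¹ • Z) := by
    rw [smul_assoc, ← algebraMap_smul B (2 : k)⁻¹ Z, ← algebraMap_smul B (2 : k)⁻¹,
      smul_smul, smul_smul, mul_comm]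
  rw [h1, ← smul_add, ← h.half, ← h.bracket, smul_mul_smul_comm, smul_mul_smul_comm, mul_comm v u,
    smul_sub]

theorem smul_add_smul [Fact p.Prime] [CharP k p] (h : IsHeisenbergTriple k d X Y Z)
    (hd : 2 * d ≤ p) (u v : B) :
    (u • X + v • Y) ^ d = 0 ∧ truncExp k p (u • X + v • Y)
      = truncExp k p (v • Y) * truncExp k p (u • X)
        * truncExp k p (((2 : k)⁻¹ • (u * v)) • Z) := by
  have hp := (Fact.out : p.Prime).pos
  refine pow_eq_zero_and_truncExp_add (by omega) (h.smul_bracket u v)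
    ((h.commute_Z_X.smul_left _).smul_right _) ((h.commute_Z_Y.smul_left _).smul_right _) ?_
  intro a b c habc
  simp only [smul_pow, smul_mul_smul_comm, h.monomial_YX a b c habc, smul_zero]

theorem smul_add_smul' [Fact p.Prime] [CharP k p] (h : IsHeisenbergTriple k d X Y Z)
    (hd : 2 * d ≤ p) (u v : B) :
    truncExp k p (u • X + v • Y) = truncExp k p (u • X) * truncExp k p (v • Y)
        * truncExp k p (-(((2 : k)⁻¹ • (u * v)) • Z)) := by
  have hp := (Fact.out : p.Prime).pos
  rw [add_comm]
  refine (pow_eq_zero_and_truncExp_add (d := d) (by omega) ?_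
    ((h.commute_Z_Y.smul_left _).smul_right _).neg_left
    ((h.commute_Z_X.smul_left _).smul_right _).neg_left ?_).2
  · rw [← neg_sub, h.smul_bracket u v, neg_add]
  · intro a b c habc
    rw [← neg_smul]
    simp only [smul_pow, smul_mul_smul_comm, h.monomial_XY a b c habc, smul_zero]

/-- The exponential of `u • X + v • Y` is factored with `Y` first and with `X` first; comparing the
two combines the half brackets into `(u * v) • Z`. -/
theorem truncExp_X_mul_Y [Fact p.Prime] [CharP k p] (h : IsHeisenbergTriple k d X Y Z)
    (hd : 2 * d ≤ p) (u v : B) :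
    truncExp k p (u • X) * truncExp k p (v • Y)
      = truncExp k p (v • Y) * truncExp k p (u • X) * truncExp k p ((u * v) • Z) := by
  have hp := (Fact.out : p.Prime).ne_zero
  have h1 := h.smul_add_smul' hd u v
  rw [(h.smul_add_smul hd u v).2, ← neg_smul] at h1
  have h2 := congrArg (· * truncExp k p (((2 : k)⁻¹ • (u * v)) • Z)) h1
  have h3 : ((2 : k)⁻¹ • (u * v)) • Z + ((2 : k)⁻¹ • (u * v)) • Z = (u * v) • Z := by
    rw [← h.smul_bracket, ← h.bracket, smul_mul_smul_comm, smul_mul_smul_comm, mul_comm v u,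
      smul_sub]
  simp only [mul_assoc, ← h.truncExp_add_smul_Z hd, neg_add_cancel, zero_smul, truncExp_zero hp,
    mul_one] at h2
  rw [add_smul, h3] at h2
  rw [← h2, mul_assoc]

/-- The only noncommuting swap is `u • X` past `v' • Y`; it produces the term `u * v'` of the
Heisenberg multiplication. -/
theorem heisenbergExp_mul [Fact p.Prime] [CharP k p] (h : IsHeisenbergTriple k d X Y Z)
    (hd : 2 * d ≤ p) (u v w u' v' w' : B) :
    heisenbergExp k p X Y Z u v w * heisenbergExp k p X Y Z u' v' w'
      = heisenbergExp k p X Y Z (u + u') (v + v') (w + w' + u * v') := by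
  have hZY : ∀ s t : B, Commute (truncExp k p (s • Z)) (truncExp k p (t • Y)) := fun s t =>
    ((h.commute_Z_Y.smul_left s).smul_right t).truncExp
  have hZX : ∀ s t : B, Commute (truncExp k p (s • Z)) (truncExp k p (t • X)) := fun s t =>
    ((h.commute_Z_X.smul_left s).smul_right t).truncExp
  have hY : truncExp k p ((v + v') • Y) = truncExp k p (v • Y) * truncExp k p (v' • Y) := by
    rw [add_smul]
    exact truncExp_add_of_commute (by omega) (((Commute.refl Y).smul_left _).smul_right _)
      (h.smul_pow_Y _) (h.smul_pow_Y _)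
  have hX : truncExp k p ((u + u') • X) = truncExp k p (u • X) * truncExp k p (u' • X) := by
    rw [add_smul]
    exact truncExp_add_of_commute (by omega) (((Commute.refl X).smul_left _).smul_right _)
      (h.smul_pow_X _) (h.smul_pow_X _)
  rw [heisenbergExp, heisenbergExp, heisenbergExp, hX, hY,
    show w + w' + u * v' = u * v' + (w + w') by ring, h.truncExp_add_smul_Z hd,
    h.truncExp_add_smul_Z hd]
  have hXY := h.truncExp_X_mul_Y hd u v'
  have c1 := hZY w v'
  have c2 := hZX w u'
  have c3 := hZX (u * v') u'
  generalize truncExp k p (v • Y) = E1 at *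
  generalize truncExp k p (u • X) = E2 at *
  generalize truncExp k p (w • Z) = E3 at *
  generalize truncExp k p (v' • Y) = E4 at *
  generalize truncExp k p (u' • X) = E5 at *
  generalize truncExp k p (w' • Z) = E6 at *
  generalize truncExp k p ((u * v') • Z) = E7 at *
  calc E1 * E2 * E3 * (E4 * E5 * E6) = E1 * E2 * (E3 * E4) * E5 * E6 := by noncomm_ring
    _ = E1 * (E2 * E4) * (E3 * E5) * E6 := by rw [c1.eq]; noncomm_ring
    _ = E1 * E4 * E2 * (E7 * E5) * E3 * E6 := by rw [c2.eq, hXY]; noncomm_ring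
    _ = E1 * E4 * (E2 * E5) * (E7 * (E3 * E6)) := by rw [c3.eq]; noncomm_ring

theorem exponent [Fact p.Prime] [CharP k p] (h : IsHeisenbergTriple k d X Y Z)
    (hd : 2 * d ≤ p) (u v w : B) :
    (u • X + v • Y + (w - (2 : k)⁻¹ • (u * v)) • Z) ^ p = 0 ∧
      truncExp k p (u • X + v • Y + (w - (2 : k)⁻¹ • (u * v)) • Z)
        = heisenbergExp k p X Y Z u v w := by
  have hc : Commute (u • X + v • Y) ((w - (2 : k)⁻¹ • (u * v)) • Z) :=
    ((h.commute_Z_X.symm.smul_left _).add_left (h.commute_Z_Y.symm.smul_left _)).smul_right _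
  obtain ⟨h1, h2⟩ := h.smul_add_smul hd u v
  refine ⟨hc.add_pow_eq_zero_of_add_le_succ_of_pow_eq_zero h1 (h.smul_pow_Z _) (by omega), ?_⟩
  rw [truncExp_add_of_commute (by omega) hc h1 (h.smul_pow_Z _), h2, mul_assoc,
    ← h.truncExp_add_smul_Z hd, add_sub_cancel, heisenbergExp]

end IsHeisenbergTriple
end heisenbergExp

/-! ### Base change and products over Frobenius twists. -/

section Matrices

variable {k : Type*} [Field k] {d : ℕ}

/-- Base change of matrices from `k` to a `k`-algebra. -/
noncomputable def matrixBaseChange (B : Type*) [CommRing B] [Algebra k B] :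
    Matrix (Fin d) (Fin d) k →ₐ[k] Matrix (Fin d) (Fin d) B :=
  (Algebra.ofId k B).mapMatrix

theorem matrixBaseChange_apply (B : Type*) [CommRing B] [Algebra k B]
    (T : Matrix (Fin d) (Fin d) k) : matrixBaseChange B T = T.map (algebraMap k B) := rfl

theorem mapMatrix_matrixBaseChange {B B' : Type*} [CommRing B] [Algebra k B] [CommRing B']
    [Algebra k B'] (f : B →ₐ[k] B') (T : Matrix (Fin d) (Fin d) k) :
    f.mapMatrix (matrixBaseChange B T) = matrixBaseChange B' T := by
  ext i j
  simp [matrixBaseChange_apply]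

theorem mapMatrix_smul {B B' : Type*} [CommRing B] [Algebra k B] [CommRing B']
    [Algebra k B'] (f : B →ₐ[k] B') (u : B) (T : Matrix (Fin d) (Fin d) B) :
    f.mapMatrix (u • T) = f u • f.mapMatrix T := by
  ext i j
  simp

theorem map_truncExp {R S : Type*} [Ring R] [Algebra k R] [Ring S] [Algebra k S] (f : R →ₐ[k] S)
    (p : ℕ) (a : R) : f (truncExp k p a) = truncExp k p (f a) := by
  simp [truncExp, map_sum, map_smul, map_pow]

/-- Monomials are shown to vanish by counting dimensions over the field `k`; this transports the
result to matrices over `k`-algebras. -/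
theorem IsHeisenbergTriple.map {R S : Type*} [Ring R] [Algebra k R] [Ring S] [Algebra k S]
    {X Y Z : R} (h : IsHeisenbergTriple k d X Y Z) (f : R →ₐ[k] S) :
    IsHeisenbergTriple k d (f X) (f Y) (f Z) where
  bracket := by rw [← map_mul, ← map_mul, ← map_sub, h.bracket]
  commute_Z_X := h.commute_Z_X.map f
  commute_Z_Y := h.commute_Z_Y.map f
  half := by rw [← map_smul, ← map_add, ← h.half]
  monomial_YX a b c habc := by
    rw [← map_pow, ← map_pow, ← map_pow, ← map_mul, ← map_mul, h.monomial_YX a b c habc, map_zero]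
  monomial_XY a b c habc := by
    rw [← map_pow, ← map_pow, ← map_pow, ← map_mul, ← map_mul, h.monomial_XY a b c habc, map_zero]

theorem IsDividedPowerSeq.map {R S : Type*} [Ring R] [Ring S] {A : ℕ → R}
    (h : IsDividedPowerSeq A) (f : R →+* S) : IsDividedPowerSeq fun n => f (A n) where
  zero := by rw [h.zero, map_one]
  mul m n := by rw [← map_mul, h.mul, map_nsmul]

theorem IsHeisenbergFamily.isHeisenbergTriple {ι : Type*} {X Y Z : ι → Matrix (Fin d) (Fin d) k}
    (h : IsHeisenbergFamily X Y Z) {p : ℕ} [Fact p.Prime] [CharP k p] (hd : 2 * d ≤ p) (i : ι) :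
    IsHeisenbergTriple k d (X i) (Y i) (Z i) where
  bracket := h.bracket_X_Y i
  commute_Z_X := h.commute_Z_X i
  commute_Z_Y := h.commute_Z_Y i
  half := by
    by_cases h2 : (2 : k) = 0
    -- Here `p = 2`, so `d ≤ 1` and `Z`, a monomial of weight `2`, vanishes.
    · have hp : p ∣ 2 := (CharP.cast_eq_zero_iff k p 2).1 (by exact_mod_cast h2)
      have := Nat.le_of_dvd two_pos hp
      have h0 := monomial_eq_zero_of_heisenberg (h.nilpotent_X i) (h.nilpotent_Y i)
        (h.nilpotent_Z i) (h.bracket_X_Y i) (h.commute_Z_X i) (h.commute_Z_Y i)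
        (a := 0) (b := 0) (c := 1) (by omega)
      simp only [pow_zero, pow_one, one_mul] at h0
      rw [h0]; simp
    · rw [← add_smul, ← two_mul, mul_inv_cancel₀ h2, one_smul]
  monomial_YX a b c := monomial_eq_zero_of_heisenberg (h.nilpotent_X i) (h.nilpotent_Y i)
    (h.nilpotent_Z i) (h.bracket_X_Y i) (h.commute_Z_X i) (h.commute_Z_Y i)
  monomial_XY a b c habc := by
    -- Exchanging `X` and `Y` replaces `Z` by `-Z`; the sign is removed afterwards.
    have h0 := monomial_eq_zero_of_heisenberg (h.nilpotent_Y i) (h.nilpotent_X i)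
      (h.nilpotent_Z i).neg (by rw [← neg_sub, h.bracket_X_Y i]) (h.commute_Z_Y i).neg_left
      (h.commute_Z_X i).neg_left habc
    rw [neg_pow, ((Commute.neg_one_left (Z i)).pow_pow c c).eq, ← mul_assoc] at h0
    have h1 := congrArg (· * (-1 : Matrix (Fin d) (Fin d) k) ^ c) h0
    have h2 : (-1 : Matrix (Fin d) (Fin d) k) ^ c * (-1) ^ c = 1 := by
      rw [← (Commute.refl _).mul_pow, neg_mul_neg, one_mul, one_pow]
    simpa only [mul_assoc, h2, mul_one, zero_mul] using h1

/-- The product over `i` of the matrices `heisenbergExp` at the points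
`(u ^ p ^ i, v ^ p ^ i, w ^ p ^ i)`. -/
noncomputable def familyExp {B : Type*} [CommRing B] [Algebra k B] (p : ℕ) {m : ℕ}
    (X Y Z : Fin m → Matrix (Fin d) (Fin d) k) (u v w : B) : Matrix (Fin d) (Fin d) B :=
  (List.ofFn fun i : Fin m => heisenbergExp k p (matrixBaseChange B (X i))
    (matrixBaseChange B (Y i)) (matrixBaseChange B (Z i))
    (u ^ p ^ (i : ℕ)) (v ^ p ^ (i : ℕ)) (w ^ p ^ (i : ℕ))).prod

theorem mapMatrix_familyExp {B B' : Type*} [CommRing B] [Algebra k B] [CommRing B']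
    [Algebra k B'] (f : B →ₐ[k] B') (p : ℕ) {m : ℕ}
    (X Y Z : Fin m → Matrix (Fin d) (Fin d) k) (u v w : B) :
    f.mapMatrix (familyExp p X Y Z u v w) = familyExp p X Y Z (f u) (f v) (f w) := by
  rw [familyExp, map_list_prod, List.map_ofFn, familyExp]
  congr 2
  funext i
  simp only [Function.comp_apply, heisenbergExp, map_mul, map_truncExp, mapMatrix_smul, map_pow,
    mapMatrix_matrixBaseChange]

theorem IsHeisenbergFamily.commute_matrixBaseChange {ι : Type*}
    {X Y Z : ι → Matrix (Fin d) (Fin d) k}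
    (h : IsHeisenbergFamily X Y Z) (B : Type*) [CommRing B] [Algebra k B] {i j : ι} (hij : i ≠ j) :
    ∀ P ∈ ({matrixBaseChange B (X i), matrixBaseChange B (Y i), matrixBaseChange B (Z i)} : Set _),
    ∀ Q ∈ ({matrixBaseChange B (X j), matrixBaseChange B (Y j), matrixBaseChange B (Z j)} : Set _),
      Commute P Q := by
  intro P hP Q hQ
  have hc := h.commute_of_ne i j hij
  have hP' : ∃ P' ∈ ({X i, Y i, Z i} : Set _), matrixBaseChange B P' = P := by
    rcases hP with rfl | rfl | rfl
    exacts [⟨_, by simp, rfl⟩, ⟨_, by simp, rfl⟩, ⟨_, by simp, rfl⟩]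
  have hQ' : ∃ Q' ∈ ({X j, Y j, Z j} : Set _), matrixBaseChange B Q' = Q := by
    rcases hQ with rfl | rfl | rfl
    exacts [⟨_, by simp, rfl⟩, ⟨_, by simp, rfl⟩, ⟨_, by simp, rfl⟩]
  obtain ⟨P', hP', rfl⟩ := hP'
  obtain ⟨Q', hQ', rfl⟩ := hQ'
  exact (hc P' hP' Q' hQ').map _

/-- Factors of different index commute, so the products merge index by index. Taking `p ^ i`-th
powers is a ring homomorphism on `B`, hence compatible with the group law. -/
theorem IsHeisenbergFamily.familyExp_mul {B : Type*} [CommRing B] [Algebra k B] {p m : ℕ}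
    [Fact p.Prime] [CharP k p] [CharP B p] (hd : 2 * d ≤ p)
    {X Y Z : Fin m → Matrix (Fin d) (Fin d) k} (h : IsHeisenbergFamily X Y Z)
    (u v w u' v' w' : B) :
    familyExp p X Y Z u v w * familyExp p X Y Z u' v' w'
      = familyExp p X Y Z (u + u') (v + v') (w + w' + u * v') := by
  rw [familyExp, familyExp, ← List.prod_ofFn_mul_distrib fun i j hij =>
    commute_heisenbergExp (h.commute_matrixBaseChange B hij), familyExp]
  congr 2
  funext i
  rw [((h.isHeisenbergTriple hd i).map (matrixBaseChange B)).heisenbergExp_mul hd]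
  simp only [add_pow_char_pow, mul_pow]

theorem familyExp_zero {B : Type*} [CommRing B] [Algebra k B] {p m : ℕ} [Fact p.Prime]
    (X Y Z : Fin m → Matrix (Fin d) (Fin d) k) : familyExp p X Y Z (0 : B) 0 0 = 1 := by
  have hp := (Fact.out : p.Prime).ne_zero
  rw [familyExp]
  refine List.prod_eq_one fun x hx => ?_
  obtain ⟨i, rfl⟩ := List.mem_ofFn.1 hx
  simp [hp, heisenbergExp_zero hp]

theorem IsHeisenbergFamily.heisenbergExponent_pow {p m : ℕ} [Fact p.Prime] [CharP k p]
    (hd : 2 * d ≤ p) {X Y Z : Fin m → Matrix (Fin d) (Fin d) k} (h : IsHeisenbergFamily X Y Z)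
    (i : Fin m) (q : ℕ) : heisenbergExponent q (X i) (Y i) (Z i) ^ p = 0 :=
  (((h.isHeisenbergTriple hd i).map (matrixBaseChange (HeisenbergAlgebra k))).exponent hd
    (HeisenbergAlgebra.x k ^ q) (HeisenbergAlgebra.y k ^ q) (HeisenbergAlgebra.z k ^ q)).1

theorem IsHeisenbergFamily.heisenbergFormula_eq {p m : ℕ} [Fact p.Prime] [CharP k p]
    (hd : 2 * d ≤ p) {X Y Z : Fin (m + 1) → Matrix (Fin d) (Fin d) k}
    (h : IsHeisenbergFamily X Y Z) :
    heisenbergFormula p m X Y Z = familyExp p X Y Z (HeisenbergAlgebra.x k)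
      (HeisenbergAlgebra.y k) (HeisenbergAlgebra.z k) := by
  rw [heisenbergFormula, familyExp]
  congr 2
  funext i
  rw [nilExp_eq_truncExp (h.heisenbergExponent_pow hd i _)]
  exact (((h.isHeisenbergTriple hd i).map (matrixBaseChange (HeisenbergAlgebra k))).exponent hd
    (HeisenbergAlgebra.x k ^ p ^ (i : ℕ)) (HeisenbergAlgebra.y k ^ p ^ (i : ℕ))
    (HeisenbergAlgebra.z k ^ p ^ (i : ℕ))).2

end Matrices

/-! ### Comodules as matrices over a bialgebra. -/

section Comodules

variable {k A V : Type*} [Field k] [CommRing A] [Bialgebra k A] [AddCommGroup V] [Module k V]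
  {d : ℕ}

/-- The matrices `a` over a bialgebra with `Δ a_ij = ∑ l, a_il ⊗ a_lj` and `ε a_ij = δ_ij`. -/
structure IsCorepMatrix (k : Type*) {A : Type*} [Field k] [CommRing A] [Bialgebra k A] {d : ℕ}
    (a : Matrix (Fin d) (Fin d) A) : Prop where
  comul : ∀ i j, Coalgebra.comul (R := k) (a i j) = ∑ l, a i l ⊗ₜ[k] a l j
  counit : ∀ i j, Coalgebra.counit (R := k) (a i j) = if i = j then 1 else 0

theorem IsCorepMatrix.exists_hasMatrix {a : Matrix (Fin d) (Fin d) A} (ha : IsCorepMatrix k a)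
    (b : Module.Basis (Fin d) k V) : ∃ M : RightComodule k A V, M.HasMatrix b a := by
  have hb : ∀ j, b.constr k (fun j => ∑ i, b i ⊗ₜ[k] a i j) (b j) = ∑ i, b i ⊗ₜ[k] a i j :=
    fun j => b.constr_basis k _ j
  refine ⟨⟨b.constr k fun j => ∑ i, b i ⊗ₜ[k] a i j, b.ext fun j => ?_, b.ext fun j => ?_⟩, hb⟩
  · simp only [LinearMap.comp_apply, hb, map_sum, LinearMap.lTensor_tmul, LinearMap.rTensor_tmul,
      ha.comul, TensorProduct.tmul_sum, TensorProduct.sum_tmul, LinearEquiv.coe_coe,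
      TensorProduct.assoc_tmul]
    rw [Finset.sum_comm]
  · simp only [LinearMap.comp_apply, hb, map_sum, LinearMap.lTensor_tmul, ha.counit]
    rw [Finset.sum_eq_single j (fun i _ hij => by simp [hij]) (by simp)]
    simp

theorem Module.Basis.sum_tmul_injective {N : Type*} [AddCommGroup N] [Module k N]
    (b : Module.Basis (Fin d) k V) {f g : Fin d → N}
    (h : ∑ i, b i ⊗ₜ[k] f i = ∑ i, b i ⊗ₜ[k] g i) : f = g := by
  funext i
  have h1 := congrArg (fun t => TensorProduct.equivFinsuppOfBasisLeft b t i) h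
  simpa [Finsupp.single_apply, Finsupp.finsetSum_apply] using h1

theorem RightComodule.exists_hasMatrix (M : RightComodule k A V) (b : Module.Basis (Fin d) k V) :
    ∃ a : Matrix (Fin d) (Fin d) A, M.HasMatrix b a ∧ IsCorepMatrix k a := by
  have hM : ∀ j, M.coact (b j)
      = ∑ i, b i ⊗ₜ[k] TensorProduct.equivFinsuppOfBasisLeft b (M.coact (b j)) i := by
    intro j
    conv_lhs => rw [← (TensorProduct.equivFinsuppOfBasisLeft b).symm_apply_apply (M.coact (b j)),
      TensorProduct.equivFinsuppOfBasisLeft_symm_apply]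
    exact Finsupp.sum_fintype _ _ (by simp)
  generalize ha : (Matrix.of fun i j =>
    TensorProduct.equivFinsuppOfBasisLeft b (M.coact (b j)) i) = a
  replace hM : ∀ j, M.coact (b j) = ∑ i, b i ⊗ₜ[k] a i j := by
    intro j
    rw [hM j, ← ha]; rfl
  refine ⟨a, hM, ⟨fun i j => ?_, fun i j => ?_⟩⟩
  · have h1 := LinearMap.congr_fun M.coassoc (b j)
    simp only [LinearMap.comp_apply, hM, map_sum, LinearMap.lTensor_tmul, LinearMap.rTensor_tmul,
      TensorProduct.sum_tmul, LinearEquiv.coe_coe, TensorProduct.assoc_tmul] at h1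
    rw [Finset.sum_comm] at h1
    simp only [← TensorProduct.tmul_sum] at h1
    exact congrFun (b.sum_tmul_injective h1) i
  · have h1 := LinearMap.congr_fun M.counit (b j)
    simp only [LinearMap.comp_apply, hM, map_sum, LinearMap.lTensor_tmul] at h1
    have h2 : (TensorProduct.rid k V).symm.toLinearMap (b j)
        = ∑ i, b i ⊗ₜ[k] (if i = j then (1 : k) else 0) := by
      rw [Finset.sum_eq_single j (fun i _ hij => by simp [hij]) (by simp)]
      simp
    exact congrFun (b.sum_tmul_injective (h1.trans h2)) i

end Comodules

/-! ### Matrices over `k[x, y, z]` as functions on points of the group. -/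

section EvalMatrix

variable {k : Type*} [Field k] {d : ℕ}

/-- The value of a matrix over `k[x, y, z]` at the point `(u, v, w)` of the Heisenberg group. -/
noncomputable def evalMatrix (a : Matrix (Fin d) (Fin d) (HeisenbergAlgebra k)) {B : Type*}
    [CommRing B] [Algebra k B] (u v w : B) : Matrix (Fin d) (Fin d) B :=
  (HeisenbergAlgebra.lift k u v w).mapMatrix a

variable {a : Matrix (Fin d) (Fin d) (HeisenbergAlgebra k)}

theorem evalMatrix_generic : evalMatrix a (HeisenbergAlgebra.x k) (HeisenbergAlgebra.y k)
    (HeisenbergAlgebra.z k) = a := by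
  have h : HeisenbergAlgebra.lift k (HeisenbergAlgebra.x k) (HeisenbergAlgebra.y k)
      (HeisenbergAlgebra.z k) = AlgHom.id k _ := by
    apply HeisenbergAlgebra.hom_ext <;> simp
  rw [evalMatrix, h]
  ext i j
  rfl

theorem map_evalMatrix {B B' : Type*} [CommRing B] [Algebra k B] [CommRing B'] [Algebra k B']
    (f : B →ₐ[k] B') (u v w : B) :
    f.mapMatrix (evalMatrix a u v w) = evalMatrix a (f u) (f v) (f w) := by
  have h : f.comp (HeisenbergAlgebra.lift k u v w)
      = HeisenbergAlgebra.lift k (f u) (f v) (f w) := by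
    apply HeisenbergAlgebra.hom_ext <;> simp
  rw [evalMatrix, evalMatrix, ← h]
  rfl

/-- Two points with values in `B` give a homomorphism from the tensor square to `B`; its composite
with the comultiplication is their product. -/
theorem IsCorepMatrix.evalMatrix_mul (ha : IsCorepMatrix k a) {B : Type*} [CommRing B]
    [Algebra k B] (u v w u' v' w' : B) :
    evalMatrix a u v w * evalMatrix a u' v' w'
      = evalMatrix a (u + u') (v + v') (w + w' + u * v') := by
  let g := Algebra.TensorProduct.lift (HeisenbergAlgebra.lift k u v w)
    (HeisenbergAlgebra.lift k u' v' w') (fun _ _ => Commute.all _ _)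
  have h : g.comp (HeisenbergAlgebra.comulHom k)
      = HeisenbergAlgebra.lift k (u + u') (v + v') (w + w' + u * v') := by
    apply HeisenbergAlgebra.hom_ext
    · simp [g, HeisenbergAlgebra.comulHom, add_comm]
    · simp [g, HeisenbergAlgebra.comulHom, add_comm]
    · simp [g, HeisenbergAlgebra.comulHom]; ring
  ext i j
  have h1 : evalMatrix a (u + u') (v + v') (w + w' + u * v') i j
      = g (HeisenbergAlgebra.comulHom k (a i j)) := by
    rw [evalMatrix, ← h]; rfl
  have h2 : HeisenbergAlgebra.comulHom k (a i j) = ∑ l, a i l ⊗ₜ[k] a l j := ha.comul i j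
  rw [h1, h2, map_sum, Matrix.mul_apply]
  simp [g, evalMatrix]

theorem IsCorepMatrix.evalMatrix_zero (ha : IsCorepMatrix k a) {B : Type*} [CommRing B]
    [Algebra k B] : evalMatrix a (0 : B) 0 0 = 1 := by
  have h : (Algebra.ofId k B).comp (HeisenbergAlgebra.counitHom k)
      = HeisenbergAlgebra.lift k (0 : B) 0 0 := by
    apply HeisenbergAlgebra.hom_ext <;> simp [HeisenbergAlgebra.counitHom]
  ext i j
  have h1 : evalMatrix a (0 : B) 0 0 i j
      = algebraMap k B (HeisenbergAlgebra.counitHom k (a i j)) := by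
    rw [evalMatrix, ← h]; rfl
  have h2 : HeisenbergAlgebra.counitHom k (a i j) = if i = j then 1 else 0 := ha.counit i j
  rw [h1, h2, Matrix.one_apply]
  split_ifs <;> simp

theorem charP_heisenbergAlgebra_tensor (k : Type*) [Field k] (p : ℕ) [CharP k p] :
    CharP (HeisenbergAlgebra k ⊗[k] HeisenbergAlgebra k) p := by
  have : Nontrivial (HeisenbergAlgebra k ⊗[k] HeisenbergAlgebra k) :=
    (Algebra.TensorProduct.lift (HeisenbergAlgebra.counitHom k)
      (HeisenbergAlgebra.counitHom k) (fun _ _ => Commute.all _ _)).toRingHom.domain_nontrivial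
  exact charP_of_injective_algebraMap
    (algebraMap k (HeisenbergAlgebra k ⊗[k] HeisenbergAlgebra k)).injective p

/-- The multiplication law is applied to the two generic points of the group in the tensor square,
whose product is the image of `(x, y, z)` under comultiplication. -/
theorem IsHeisenbergFamily.isCorepMatrix {p m : ℕ} [Fact p.Prime] [CharP k p]
    (hd : 2 * d ≤ p) {X Y Z : Fin m → Matrix (Fin d) (Fin d) k} (h : IsHeisenbergFamily X Y Z) :
    IsCorepMatrix k (familyExp p X Y Z (HeisenbergAlgebra.x k) (HeisenbergAlgebra.y k)
      (HeisenbergAlgebra.z k)) := by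
  have := charP_heisenbergAlgebra_tensor k p
  set a := familyExp p X Y Z (HeisenbergAlgebra.x k) (HeisenbergAlgebra.y k)
    (HeisenbergAlgebra.z k) with ha
  constructor
  · have h1 := h.familyExp_mul hd (HeisenbergAlgebra.x k ⊗ₜ[k] (1 : HeisenbergAlgebra k))
      (HeisenbergAlgebra.y k ⊗ₜ[k] 1) (HeisenbergAlgebra.z k ⊗ₜ[k] 1)
      ((1 : HeisenbergAlgebra k) ⊗ₜ[k] HeisenbergAlgebra.x k) (1 ⊗ₜ[k] HeisenbergAlgebra.y k)
      (1 ⊗ₜ[k] HeisenbergAlgebra.z k)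
    have hl := mapMatrix_familyExp (Algebra.TensorProduct.includeLeft :
      HeisenbergAlgebra k →ₐ[k] HeisenbergAlgebra k ⊗[k] HeisenbergAlgebra k) p X Y Z
      (HeisenbergAlgebra.x k) (HeisenbergAlgebra.y k) (HeisenbergAlgebra.z k)
    have hr := mapMatrix_familyExp (Algebra.TensorProduct.includeRight :
      HeisenbergAlgebra k →ₐ[k] HeisenbergAlgebra k ⊗[k] HeisenbergAlgebra k) p X Y Z
      (HeisenbergAlgebra.x k) (HeisenbergAlgebra.y k) (HeisenbergAlgebra.z k)
    have hc := mapMatrix_familyExp (HeisenbergAlgebra.comulHom k) p X Y Z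
      (HeisenbergAlgebra.x k) (HeisenbergAlgebra.y k) (HeisenbergAlgebra.z k)
    simp only [Algebra.TensorProduct.includeLeft_apply,
      Algebra.TensorProduct.includeRight_apply] at hl hr
    have e : HeisenbergAlgebra.comulHom k (HeisenbergAlgebra.z k)
        = HeisenbergAlgebra.z k ⊗ₜ[k] 1 + 1 ⊗ₜ[k] HeisenbergAlgebra.z k
          + (HeisenbergAlgebra.x k ⊗ₜ[k] 1) * (1 ⊗ₜ[k] HeisenbergAlgebra.y k) := by
      simp [HeisenbergAlgebra.comulHom]; abel
    rw [e, show HeisenbergAlgebra.comulHom k (HeisenbergAlgebra.x k)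
        = HeisenbergAlgebra.x k ⊗ₜ[k] 1 + 1 ⊗ₜ[k] HeisenbergAlgebra.x k by
        simp [HeisenbergAlgebra.comulHom, add_comm],
      show HeisenbergAlgebra.comulHom k (HeisenbergAlgebra.y k)
        = HeisenbergAlgebra.y k ⊗ₜ[k] 1 + 1 ⊗ₜ[k] HeisenbergAlgebra.y k by
        simp [HeisenbergAlgebra.comulHom, add_comm], ← h1, ← hl, ← hr, ← ha] at hc
    intro i j
    have h2 := congrFun (congrFun hc i) j
    rw [Matrix.mul_apply] at h2
    refine Eq.trans (b := HeisenbergAlgebra.comulHom k (a i j)) rfl (h2.trans ?_)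
    simp
  · intro i j
    have h1 := mapMatrix_familyExp (HeisenbergAlgebra.counitHom k) p X Y Z
      (HeisenbergAlgebra.x k) (HeisenbergAlgebra.y k) (HeisenbergAlgebra.z k)
    simp only [HeisenbergAlgebra.counitHom, HeisenbergAlgebra.lift_x, HeisenbergAlgebra.lift_y,
      HeisenbergAlgebra.lift_z, familyExp_zero] at h1
    rw [← Matrix.one_apply, ← h1]
    rfl

end EvalMatrix

/-! ### Comparison of coefficients in `k[s][t]`. -/

section Coefficients

variable {k : Type*} [Field k] {d : ℕ}

open Polynomial

/-- The matrix of coefficients of `T ^ n` of a matrix over `k[T]`. -/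
def coeffMatrix (P : Matrix (Fin d) (Fin d) k[X]) (n : ℕ) : Matrix (Fin d) (Fin d) k :=
  P.map fun f => f.coeff n

theorem exists_forall_natDegree_lt (P : Matrix (Fin d) (Fin d) k[X]) :
    ∃ N, ∀ i j, (P i j).natDegree < N := by
  refine ⟨(Finset.univ.sup fun i => Finset.univ.sup fun j => (P i j).natDegree) + 1,
    fun i j => Nat.lt_succ_of_le ?_⟩
  exact (Finset.le_sup (f := fun j => (P i j).natDegree) (Finset.mem_univ j)).trans
    (Finset.le_sup (f := fun i => Finset.univ.sup fun j => (P i j).natDegree) (Finset.mem_univ i))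

theorem mapMatrix_aeval_eq_sum {P : Matrix (Fin d) (Fin d) k[X]} {N : ℕ}
    (hN : ∀ i j, (P i j).natDegree < N) {B : Type*} [CommRing B] [Algebra k B] (u : B) :
    (aeval u).mapMatrix P
      = ∑ n ∈ Finset.range N, u ^ n • matrixBaseChange B (coeffMatrix P n) := by
  ext i j
  rw [Matrix.sum_apply]
  simp only [AlgHom.mapMatrix_apply, Matrix.map_apply, aeval_eq_sum_range' (hN i j) u,
    Matrix.smul_apply, matrixBaseChange_apply, coeffMatrix, Algebra.smul_def]
  exact Finset.sum_congr rfl fun n _ => mul_comm _ _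

theorem coeffMatrix_zero (P : Matrix (Fin d) (Fin d) k[X]) :
    coeffMatrix P 0 = (aeval (0 : k)).mapMatrix P := by
  ext i j
  simp [coeffMatrix, coeff_zero_eq_aeval_zero]

/-- The coefficient of `s ^ m * t ^ n` of a polynomial in `k[s][t]`. -/
noncomputable def biCoeff (k : Type*) [Field k] (m n : ℕ) : k[X][X] →ₗ[k] k :=
  lcoeff k m ∘ₗ (lcoeff k[X] n).restrictScalars k

theorem biCoeff_pow_mul_pow (m n a b : ℕ) :
    biCoeff k m n ((C X) ^ a * X ^ b) = if a = m ∧ b = n then 1 else 0 := by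
  simp only [biCoeff, LinearMap.comp_apply, LinearMap.restrictScalars_apply, lcoeff_apply,
    ← C_pow, coeff_C_mul, coeff_X_pow]
  by_cases hb : b = n <;> by_cases ha : a = m <;> simp [ha, hb, coeff_X_pow, eq_comm]
  · simp [Ne.symm ha]
  · simp [Ne.symm hb]
  · simp [Ne.symm hb]

theorem biCoeff_add_pow (m n l : ℕ) :
    biCoeff k m n ((C X + X) ^ l) = if l = m + n then (l.choose n : k) else 0 := by
  simp only [biCoeff, LinearMap.comp_apply, LinearMap.restrictScalars_apply, lcoeff_apply]
  rw [add_comm, coeff_X_add_C_pow]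
  rcases lt_or_ge l n with h | h
  · rw [Nat.choose_eq_zero_of_lt h, if_neg (by omega)]; simp
  · rw [← C_eq_natCast, coeff_mul_C, coeff_X_pow]
    by_cases hl : l = m + n
    · rw [if_pos hl, if_pos (by omega)]; simp
    · rw [if_neg hl, if_neg (by omega)]; simp

/-- Coefficientwise extraction of a monomial of a matrix over `k[s][t]`. -/
noncomputable def biCoeffMatrix (m n : ℕ) :
    Matrix (Fin d) (Fin d) k[X][X] →ₗ[k] Matrix (Fin d) (Fin d) k :=
  (biCoeff k m n).mapMatrix

theorem biCoeffMatrix_smul (m n : ℕ) (f : k[X][X]) (T : Matrix (Fin d) (Fin d) k) :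
    biCoeffMatrix m n (f • matrixBaseChange k[X][X] T) = biCoeff k m n f • T := by
  ext i j
  simp only [biCoeffMatrix, LinearMap.mapMatrix_apply, Matrix.map_apply, Matrix.smul_apply,
    matrixBaseChange_apply, smul_eq_mul]
  rw [mul_comm, ← Algebra.smul_def, map_smul, smul_eq_mul, mul_comm]

variable {P Q S : Matrix (Fin d) (Fin d) k[X]}

theorem biCoeffMatrix_mul (m n : ℕ) : biCoeffMatrix m n
    ((aeval (C X : k[X][X])).mapMatrix P * (aeval (X : k[X][X])).mapMatrix Q)
      = coeffMatrix P m * coeffMatrix Q n := by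
  obtain ⟨N₁, h₁⟩ := exists_forall_natDegree_lt P
  obtain ⟨N₂, h₂⟩ := exists_forall_natDegree_lt Q
  -- The maximum keeps index `m` in the range even when it exceeds the degree.
  rw [mapMatrix_aeval_eq_sum (N := max N₁ (m + 1)) (fun i j => lt_max_of_lt_left (h₁ i j)),
    mapMatrix_aeval_eq_sum (N := max N₂ (n + 1)) (fun i j => lt_max_of_lt_left (h₂ i j)),
    Finset.sum_mul_sum]
  simp only [map_sum, smul_mul_smul_comm, ← map_mul, biCoeffMatrix_smul, biCoeff_pow_mul_pow]
  rw [Finset.sum_eq_single m, Finset.sum_eq_single n]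
  · simp
  · intro b _ hb; simp [hb]
  · intro h; simp at h
  · intro b _ hb; simp [hb]
  · intro h; simp at h

theorem isDividedPowerSeq_coeffMatrix
    (h : (aeval (C X : k[X][X])).mapMatrix P * (aeval (X : k[X][X])).mapMatrix P
      = (aeval (C X + X : k[X][X])).mapMatrix P) (h0 : coeffMatrix P 0 = 1) :
    IsDividedPowerSeq (coeffMatrix P) where
  zero := h0
  mul m n := by
    obtain ⟨N, hN⟩ := exists_forall_natDegree_lt P
    rw [← biCoeffMatrix_mul, h,
      mapMatrix_aeval_eq_sum (N := max N (m + n + 1)) (fun i j => lt_max_of_lt_left (hN i j))]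
    simp only [map_sum, biCoeffMatrix_smul, biCoeff_add_pow]
    rw [Finset.sum_eq_single (m + n)]
    · rw [if_pos rfl, Nat.cast_smul_eq_nsmul, Nat.choose_symm_add]
    · intro b _ hb; simp [hb]
    · intro h; simp at h

theorem commute_coeffMatrix
    (h : (aeval (C X : k[X][X])).mapMatrix P * (aeval (X : k[X][X])).mapMatrix Q
      = (aeval (X : k[X][X])).mapMatrix Q * (aeval (C X : k[X][X])).mapMatrix P) (m n : ℕ) :
    Commute (coeffMatrix P m) (coeffMatrix Q n) := by
  obtain ⟨N₁, h₁⟩ := exists_forall_natDegree_lt P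
  obtain ⟨N₂, h₂⟩ := exists_forall_natDegree_lt Q
  rw [Commute, SemiconjBy, ← biCoeffMatrix_mul, h,
    mapMatrix_aeval_eq_sum (N := max N₁ (m + 1)) (fun i j => lt_max_of_lt_left (h₁ i j)),
    mapMatrix_aeval_eq_sum (N := max N₂ (n + 1)) (fun i j => lt_max_of_lt_left (h₂ i j)),
    Finset.sum_mul_sum]
  simp only [map_sum, smul_mul_smul_comm, ← map_mul, biCoeffMatrix_smul,
    mul_comm (X ^ _ : k[X][X]), biCoeff_pow_mul_pow]
  rw [Finset.sum_eq_single n, Finset.sum_eq_single m]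
  · simp
  · intro b _ hb; simp [hb]
  · intro h; simp at h
  · intro b _ hb; simp [hb]
  · intro h; simp at h

/-- In `Q(t) P(s) S(st)`, the `r`-th term of `S` contributes to `s ^ m * t ^ n` only through the
coefficients `m - r` of `P` and `n - r` of `Q`. -/
theorem coeffMatrix_mul_eq_sum
    (h : (aeval (C X : k[X][X])).mapMatrix P * (aeval (X : k[X][X])).mapMatrix Q
      = (aeval (X : k[X][X])).mapMatrix Q * (aeval (C X : k[X][X])).mapMatrix P
        * (aeval (C X * X : k[X][X])).mapMatrix S) (m n : ℕ) :
    coeffMatrix P m * coeffMatrix Q n = ∑ r ∈ Finset.range (min m n + 1),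
      coeffMatrix Q (n - r) * coeffMatrix P (m - r) * coeffMatrix S r := by
  obtain ⟨N₁, h₁⟩ := exists_forall_natDegree_lt P
  obtain ⟨N₂, h₂⟩ := exists_forall_natDegree_lt Q
  obtain ⟨N₃, h₃⟩ := exists_forall_natDegree_lt S
  rw [← biCoeffMatrix_mul, h,
    mapMatrix_aeval_eq_sum (N := max N₁ (m + 1)) (fun i j => lt_max_of_lt_left (h₁ i j)),
    mapMatrix_aeval_eq_sum (N := max N₂ (n + 1)) (fun i j => lt_max_of_lt_left (h₂ i j)),
    mapMatrix_aeval_eq_sum (N := max N₃ (min m n + 1)) (fun i j => lt_max_of_lt_left (h₃ i j)),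
    Finset.sum_mul_sum, Finset.mul_sum]
  have hpow : ∀ i j r : ℕ, (X ^ j * C X ^ i * (C X * X) ^ r : k[X][X])
      = C X ^ (i + r) * X ^ (j + r) := fun i j r => by ring
  simp only [Finset.sum_mul, map_sum, smul_mul_smul_comm, ← map_mul,
    biCoeffMatrix_smul, hpow, biCoeff_pow_mul_pow]
  symm
  refine Finset.sum_subset_zero_on_sdiff (Finset.range_mono (le_max_right _ _)) ?_ ?_
  · intro r hr
    simp only [Finset.mem_sdiff, Finset.mem_range, not_lt] at hr
    refine Finset.sum_eq_zero fun j _ => Finset.sum_eq_zero fun i _ => ?_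
    rw [if_neg (by omega), zero_smul]
  · intro r hr
    rw [Finset.mem_range] at hr
    rw [Finset.sum_eq_single (n - r), Finset.sum_eq_single (m - r)]
    · rw [if_pos (by omega), one_smul]
    · intro b _ hb; rw [if_neg (by omega), zero_smul]
    · intro h
      simp only [Finset.mem_range, not_lt] at h
      have := le_max_right N₁ (m + 1)
      omega
    · intro b _ hb
      refine Finset.sum_eq_zero fun i _ => ?_
      rw [if_neg (by omega), zero_smul]
    · intro h
      simp only [Finset.mem_range, not_lt] at h
      have := le_max_right N₂ (n + 1)
      omega

/-- Cayley–Hamilton: the characteristic polynomial is `X ^ d`. This sharpens the exponent `p` coming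
from divided powers to the `d` that the digit argument needs. -/
theorem pow_eq_zero_of_isNilpotent {T : Matrix (Fin d) (Fin d) k} (h : IsNilpotent T) :
    T ^ d = 0 := by
  have h1 := Matrix.isNilpotent_charpoly_sub_pow_of_isNilpotent h
  have h2 : T.charpoly = X ^ d := by
    simpa [sub_eq_zero] using h1.eq_zero
  simpa [h2] using T.aeval_self_charpoly

end Coefficients

/-! ### From a representation to a Heisenberg family. -/

theorem IsDividedPowerSeq.pow_prime_pow_char {k R : Type*} [Field k] [Ring R] [Algebra k R] {p : ℕ}
    [Fact p.Prime] [CharP k p] {A : ℕ → R} (hA : IsDividedPowerSeq A) (i : ℕ) :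
    A (p ^ i) ^ p = 0 := by
  simpa using (hA.comp_pow_mul (k := k) (p := p) i).pow_char_eq_zero (k := k) (p := p)

/-- Divided power sequences `A, B` whose generating series have commutator `C`, with `C` central,
commute at powers of `p` up to the expected bracket. -/
theorem IsDividedPowerSeq.commutator_prime_pow {k R : Type*} [Field k] [Ring R] [Algebra k R]
    {p d : ℕ} [Fact p.Prime] [CharP k p] (hd : 2 * d ≤ p) {A B C : ℕ → R}
    (hA : IsDividedPowerSeq A) (hB : IsDividedPowerSeq B) (hC : IsDividedPowerSeq C)
    (hAd : ∀ i, A (p ^ i) ^ d = 0) (hBd : ∀ i, B (p ^ i) ^ d = 0) (hCd : ∀ i, C (p ^ i) ^ d = 0)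
    (hCA : ∀ m n, Commute (C m) (A n))
    (h : ∀ m n, A m * B n = ∑ r ∈ Finset.range (min m n + 1), B (n - r) * A (m - r) * C r)
    (i j : ℕ) :
    A (p ^ i) * B (p ^ j) - B (p ^ j) * A (p ^ i) = if i = j then C (p ^ i) else 0 := by
  have hp := (Fact.out : p.Prime)
  rw [h, Finset.sum_range_succ', hC.zero, Nat.sub_zero, Nat.sub_zero, mul_one, add_sub_cancel_right]
  -- `C (r + 1)` meets `A (p ^ i - (r + 1))` or `B (p ^ j - (r + 1))`, and the two indices add up to
  -- a power of `p`. Only `r + 1 = p ^ i = p ^ j` escapes.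
  have hlt : ∀ r, r + 1 < p ^ i ∨ r + 1 < p ^ j → r < min (p ^ i) (p ^ j) →
      B (p ^ j - (r + 1)) * A (p ^ i - (r + 1)) * C (r + 1) = 0 := by
    intro r hr hr'
    rcases hr with hr | hr
    · rw [mul_assoc, hA.mul_eq_zero_of_add_eq_pow (k := k) hd i hC hAd hCd (by omega) (by omega)
        (by omega), mul_zero]
    · rw [mul_assoc, ← (hCA _ _).eq, ← mul_assoc,
        IsDividedPowerSeq.mul_eq_zero_of_add_eq_pow (k := k) hd j hB hC hBd hCd (by omega)
        (by omega) (by omega), zero_mul]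
  split_ifs with hij
  · subst hij
    have hpos : 0 < p ^ i := pow_pos hp.pos i
    rw [min_self, Finset.sum_eq_single (p ^ i - 1)]
    · rw [Nat.sub_add_cancel hpos, Nat.sub_self, hA.zero, hB.zero, one_mul, one_mul]
    · intro r hr hne
      rw [Finset.mem_range] at hr
      exact hlt r (by omega) (by rw [min_self]; exact hr)
    · intro hr
      rw [Finset.mem_range] at hr
      omega
  · have hne : p ^ i ≠ p ^ j := fun e => hij (Nat.pow_right_injective hp.two_le e)
    refine Finset.sum_eq_zero fun r hr => ?_
    rw [Finset.mem_range] at hr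
    exact hlt r (by omega) hr

section Representations

variable {k : Type*} [Field k] {d p : ℕ}

open Polynomial in
/-- A sequence of divided powers of nilpotent matrices given by the coefficients of a matrix over
`k[T]`, as a product of exponentials. -/
theorem mapMatrix_aeval_eq_prod [Fact p.Prime] [CharP k p] {P : Matrix (Fin d) (Fin d) k[X]}
    (hP : IsDividedPowerSeq (coeffMatrix P)) {m : ℕ} (hm : ∀ i j, (P i j).natDegree < p ^ m)
    {B : Type*} [CommRing B] [Algebra k B] (u : B) :
    (aeval u).mapMatrix P = (List.ofFn fun i : Fin m =>
      truncExp k p (u ^ p ^ (i : ℕ) • matrixBaseChange B (coeffMatrix P (p ^ (i : ℕ))))).prod := by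
  rw [mapMatrix_aeval_eq_sum hm]
  exact IsDividedPowerSeq.sum_pow_smul_eq_prod (k := k) m
    (hP.map (matrixBaseChange B).toRingHom) u

open Polynomial in
theorem IsCorepMatrix.exists_family [Fact p.Prime] [CharP k p] (hd : 2 * d ≤ p)
    {a : Matrix (Fin d) (Fin d) (HeisenbergAlgebra k)} (ha : IsCorepMatrix k a) :
    ∃ (m : ℕ) (X Y Z : Fin (m + 1) → Matrix (Fin d) (Fin d) k),
      IsHeisenbergFamily X Y Z ∧ a = heisenbergFormula p m X Y Z := by
  have hp := (Fact.out : p.Prime)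
  -- Restrictions to the three coordinate one-parameter subgroups.
  set PA : Matrix (Fin d) (Fin d) k[X] := evalMatrix a X 0 0 with hPA
  set PB : Matrix (Fin d) (Fin d) k[X] := evalMatrix a 0 X 0 with hPB
  set PC : Matrix (Fin d) (Fin d) k[X] := evalMatrix a 0 0 X with hPC
  have eA : ∀ {B : Type _} [CommRing B] [Algebra k B] (u : B),
      (aeval u).mapMatrix PA = evalMatrix a u 0 0 := fun u => by
    rw [hPA, map_evalMatrix, aeval_X, map_zero]
  have eB : ∀ {B : Type _} [CommRing B] [Algebra k B] (u : B),
      (aeval u).mapMatrix PB = evalMatrix a 0 u 0 := fun u => by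
    rw [hPB, map_evalMatrix, aeval_X, map_zero]
  have eC : ∀ {B : Type _} [CommRing B] [Algebra k B] (u : B),
      (aeval u).mapMatrix PC = evalMatrix a 0 0 u := fun u => by
    rw [hPC, map_evalMatrix, aeval_X, map_zero]
  have sA : IsDividedPowerSeq (coeffMatrix PA) := isDividedPowerSeq_coeffMatrix
    (by rw [eA, eA, eA, ha.evalMatrix_mul]; simp)
    (by rw [coeffMatrix_zero, eA, ha.evalMatrix_zero])
  have sB : IsDividedPowerSeq (coeffMatrix PB) := isDividedPowerSeq_coeffMatrix
    (by rw [eB, eB, eB, ha.evalMatrix_mul]; simp)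
    (by rw [coeffMatrix_zero, eB, ha.evalMatrix_zero])
  have sC : IsDividedPowerSeq (coeffMatrix PC) := isDividedPowerSeq_coeffMatrix
    (by rw [eC, eC, eC, ha.evalMatrix_mul]; simp)
    (by rw [coeffMatrix_zero, eC, ha.evalMatrix_zero])
  have cCA : ∀ m n, Commute (coeffMatrix PC m) (coeffMatrix PA n) := commute_coeffMatrix
    (by rw [eA, eC, ha.evalMatrix_mul, ha.evalMatrix_mul]; simp)
  have cCB : ∀ m n, Commute (coeffMatrix PC m) (coeffMatrix PB n) := commute_coeffMatrix
    (by rw [eB, eC, ha.evalMatrix_mul, ha.evalMatrix_mul]; simp)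
  have cAB := coeffMatrix_mul_eq_sum (P := PA) (Q := PB) (S := PC)
    (by rw [eA, eB, eC, ha.evalMatrix_mul, ha.evalMatrix_mul, ha.evalMatrix_mul]; simp)
  have nA : ∀ i, IsNilpotent (coeffMatrix PA (p ^ i)) := fun i =>
    ⟨p, sA.pow_prime_pow_char (k := k) i⟩
  have nB : ∀ i, IsNilpotent (coeffMatrix PB (p ^ i)) := fun i =>
    ⟨p, sB.pow_prime_pow_char (k := k) i⟩
  have nC : ∀ i, IsNilpotent (coeffMatrix PC (p ^ i)) := fun i =>
    ⟨p, sC.pow_prime_pow_char (k := k) i⟩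
  have hbr := sA.commutator_prime_pow (k := k) hd sB sC
    (fun i => pow_eq_zero_of_isNilpotent (nA i)) (fun i => pow_eq_zero_of_isNilpotent (nB i))
    (fun i => pow_eq_zero_of_isNilpotent (nC i)) cCA cAB
  obtain ⟨N₁, h₁⟩ := exists_forall_natDegree_lt PA
  obtain ⟨N₂, h₂⟩ := exists_forall_natDegree_lt PB
  obtain ⟨N₃, h₃⟩ := exists_forall_natDegree_lt PC
  -- A common bound: `m < p ^ (m + 1)`, so the digits of index `0, …, m` reach every nonzero
  -- coefficient.
  set m := N₁ + N₂ + N₃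
  have hm : m < p ^ (m + 1) := (Nat.lt_succ_self m).trans (Nat.lt_pow_self hp.one_lt)
  have hfam : IsHeisenbergFamily (fun i : Fin (m + 1) => coeffMatrix PA (p ^ (i : ℕ)))
      (fun i => coeffMatrix PB (p ^ (i : ℕ))) (fun i => coeffMatrix PC (p ^ (i : ℕ))) := by
    refine ⟨fun i => nA i, fun i => nB i, fun i => nC i, fun i => ?_, fun i => cCA _ _,
      fun i => cCB _ _, ?_⟩
    · rw [hbr, if_pos rfl]
    · intro i j hij
      have cXY : ∀ i j : Fin (m + 1), i ≠ j →
          Commute (coeffMatrix PA (p ^ (i : ℕ))) (coeffMatrix PB (p ^ (j : ℕ))) := by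
        intro i j hij
        have h := hbr i j
        rw [if_neg fun e => hij (Fin.ext e)] at h
        exact sub_eq_zero.1 h
      rintro P (rfl | rfl | rfl) Q (rfl | rfl | rfl)
      exacts [sA.commute _ _, cXY i j hij, (cCA _ _).symm, (cXY j i hij.symm).symm,
        sB.commute _ _, (cCB _ _).symm, cCA _ _, cCB _ _, sC.commute _ _]
  refine ⟨m, _, _, _, hfam, ?_⟩
  have hfac : a = evalMatrix a 0 (HeisenbergAlgebra.y k) 0 * evalMatrix a (HeisenbergAlgebra.x k) 0 0
      * evalMatrix a 0 0 (HeisenbergAlgebra.z k) := by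
    rw [ha.evalMatrix_mul, ha.evalMatrix_mul]
    conv_lhs => rw [← evalMatrix_generic (a := a)]
    simp
  have hc := fun i j (hij : i ≠ j) => hfam.commute_matrixBaseChange (HeisenbergAlgebra k) hij
  have hcE : ∀ {P Q : Matrix (Fin d) (Fin d) (HeisenbergAlgebra k)} (s t : HeisenbergAlgebra k),
      Commute P Q → Commute (truncExp k p (s • P)) (truncExp k p (t • Q)) := fun s t h =>
    ((h.smul_left s).smul_right t).truncExp
  rw [hfam.heisenbergFormula_eq hd, familyExp]
  simp only [heisenbergExp]
  -- Commutation across different indices lets the product over `i` be regrouped into the `Y`, `X`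
  -- and `Z` products, which are the three restrictions.
  rw [List.prod_ofFn_mul_distrib, List.prod_ofFn_mul_distrib,
    ← mapMatrix_aeval_eq_prod sA (fun i j => (h₁ i j).trans_le (by omega)),
    ← mapMatrix_aeval_eq_prod sB (fun i j => (h₂ i j).trans_le (by omega)),
    ← mapMatrix_aeval_eq_prod sC (fun i j => (h₃ i j).trans_le (by omega)), eA, eB, eC, ← hfac]
  · exact fun i j hij => hcE _ _ (hc i j hij _ (by simp) _ (by simp))
  · exact fun i j hij => (hcE _ _ (hc i j hij _ (by simp) _ (by simp))).mul_left
      (hcE _ _ (hc i j hij _ (by simp) _ (by simp)))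

end Representations

theorem theorem1p3 (k : Type*) [Field k] (p : ℕ) [Fact p.Prime] [CharP k p]
    (d : ℕ) (hpd : 2 * d ≤ p)
    (V : Type*) [AddCommGroup V] [Module k V] (b : Module.Basis (Fin d) k V) :
    (∀ M : HeisenbergRep k V,
      ∃ (m : ℕ) (X Y Z : Fin (m + 1) → Matrix (Fin d) (Fin d) k),
        IsHeisenbergFamily X Y Z ∧ M.HasMatrix b (heisenbergFormula p m X Y Z)) ∧
    (∀ (m : ℕ) (X Y Z : Fin (m + 1) → Matrix (Fin d) (Fin d) k),
      IsHeisenbergFamily X Y Z →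
        (∀ i : Fin (m + 1), IsNilpotent (heisenbergExponent (p ^ (i : ℕ)) (X i) (Y i) (Z i))) ∧
        ∃ M : HeisenbergRep k V, M.HasMatrix b (heisenbergFormula p m X Y Z)) := by
  refine ⟨fun M => ?_, fun m X Y Z h => ⟨fun i => ⟨p, h.heisenbergExponent_pow hpd i _⟩, ?_⟩⟩
  · obtain ⟨a, hM, ha⟩ := M.exists_hasMatrix b
    obtain ⟨m, X, Y, Z, h, rfl⟩ := ha.exists_family hpd
    exact ⟨m, X, Y, Z, h, hM⟩
  · rw [h.heisenbergFormula_eq hpd]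
    exact (h.isCorepMatrix hpd).exists_hasMatrix b
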